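/- Let $\mathcal X,\mathcal Y$ be finite sets, $f:\mathcal X\times\mathcal Y\to\mathcal Z$ a function, $\mu$ a probability distribution on $\mathcal X\times\mathcal Y$, and $k$ a number of rounds. In a $k$-round protocol Alice (who knows $x\in\mathcal X$) and Bob (who knows $y\in\mathcal Y$) alternately send $k$ messages, which are bit strings (possibly empty); each message depends on the sender's input, the earlier messages and, in a private-coin protocol, on the sender's own random coins, which have finite range and are independent of the inputs and of the other player's coins. A protocol is prefix-free if after every sequence of earlier messages no possible next message is a proper prefix of another one. At the end an answer in $\mathcal Z$ is determined, according to a fixed convention that is the same for all protocols: by Alice, by Bob (each from the own input, the own coins and the transcript), by the transcript alone, or by several of these, all of which then have to be right. Let $\Pi$ be a $k$-round private-coin protocol whose average error for $f$ under $\mu$, that is, the probability over $(X,Y)\sim\mu$ and the coins that the answer is not $f(X,Y)$, is at most $\delta$. Let $T$ be the complete transcript of $\Pi$ on $(X,Y)$, and suppose that its information cost satisfies $I(XY:T)=H(XY)+H(T)-H(XYT)\le a$, where $H$ is Shannon entropy in bits. Then for every $\varepsilon>0$ there is a deterministic prefix-free $k$-round protocol $\Pi'$, with the same player sending the first message, such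 that (a) on every input $(x,y)$ the total number of bits exchanged in $\Pi'$ is at most $\dfrac{2k(a+1)}{\varepsilon^2}+\dfrac{2k}{\varepsilon}$; (b) the distributional error of $\Pi'$ under $\mu$, that is, the probability over $(X,Y)\sim\mu$ that its answer is not $f(X,Y)$, is at most $\delta+2\varepsilon$. -/

import Mathlib

namespace TwoParty

/-! ### Probability and information on a finite sample space -/

open Classical in
/-- The probability of the event `E` under `p`. -/
noncomputable def prob {Ω : Type*} [Fintype Ω] (p : PMF Ω) (E : Set Ω) : ℝ :=
  ∑ ω ∈ Finset.univ.filter (fun ω => ω ∈ E), (p ω).toReal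

open Classical in
/-- Shannon entropy, in bits, of the random variable `V` on the sample space `(Ω, p)`. -/
noncomputable def entropy {Ω S : Type*} [Fintype Ω] (p : PMF Ω) (V : Ω → S) : ℝ :=
  -∑ s ∈ Finset.univ.image V, prob p {ω | V ω = s} * Real.logb 2 (prob p {ω | V ω = s})

/-- Mutual information `I(V : W) = H(V) + H(W) - H(VW)`, in bits. -/
noncomputable def mutualInfo {Ω S S' : Type*} [Fintype Ω] (p : PMF Ω)
    (V : Ω → S) (W : Ω → S') : ℝ :=
  entropy p V + entropy p W - entropy p (fun ω => (V ω, W ω))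

/-! ### Deterministic protocols -/

/-- The two players. -/
inductive Party
  | alice
  | bob

/-- The other player. -/
def Party.other : Party → Party
  | .alice => .bob
  | .bob => .alice

/-- The player who sends message number `i` (counted from `0`) when the players alternate and
`first` sends message number `0`. -/
def speaker (first : Party) (i : ℕ) : Party :=
  if Even i then first else first.other

/-- A message is a bit string. -/
abbrev Message := List Bool

/-- The list of the messages sent so far, in chronological order. -/
abbrev History := List Message

/-- Whose answer is looked at when a protocol ends: the one of Alice or of Bob, who know their own
input and the transcript, or an answer that is read off the transcript alone. -/
inductive Answerer
  | alice
  | bob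
  | transcript

/-- A deterministic two-party protocol with `k` rounds (one message per round, the players
alternate, `first` starts). A message depends on the sender's input and on the earlier messages. -/
structure Protocol (X Y Z : Type*) (k : ℕ) (first : Party) where
  /-- The message that Alice sends if it is her turn. -/
  msgAlice : X → History → Message
  /-- The message that Bob sends if it is his turn. -/
  msgBob : Y → History → Message
  /-- Alice's answer, from her input and the complete transcript. -/
  outAlice : X → History → Z
  /-- Bob's answer, from his input and the complete transcript. -/
  outBob : Y → History → Z
  /-- The answer determined by the complete transcript alone. -/
  outTranscript : History → Z

namespace Protocol

variable {X Y Z : Type*} {k : ℕ} {first : Party}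

/-- The message sent by the given player on inputs `x`, `y` after the history `h`. -/
def msg (P : Protocol X Y Z k first) (x : X) (y : Y) (h : History) : Party → Message
  | .alice => P.msgAlice x h
  | .bob => P.msgBob y h

/-- The first `i` messages on inputs `x`, `y`. -/
def history (P : Protocol X Y Z k first) (x : X) (y : Y) : ℕ → History
  | 0 => []
  | i + 1 => P.history x y i ++ [P.msg x y (P.history x y i) (speaker first i)]

/-- The complete transcript: all `k` messages. -/
def transcript (P : Protocol X Y Z k first) (x : X) (y : Y) : History :=
  P.history x y k

/-- The answers on inputs `x`, `y`. -/
def output (P : Protocol X Y Z k first) (x : X) (y : Y) : Answerer → Z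
  | .alice => P.outAlice x (P.transcript x y)
  | .bob => P.outBob y (P.transcript x y)
  | .transcript => P.outTranscript (P.transcript x y)

/-- The number of bits exchanged on inputs `x`, `y`. -/
def bits (P : Protocol X Y Z k first) (x : X) (y : Y) : ℕ :=
  ((P.transcript x y).map List.length).sum

/-- The communication cost: the maximal number of bits exchanged. -/
def cost [Fintype X] [Fintype Y] (P : Protocol X Y Z k first) : ℕ :=
  (Finset.univ : Finset (X × Y)).sup fun z => P.bits z.1 z.2

/-- After every history the possible messages form a prefix-free set, so that the receiver
recognises the end of a message and no information is hidden in message lengths. -/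
def PrefixFree (P : Protocol X Y Z k first) : Prop :=
  (∀ h x x', P.msgAlice x h <+: P.msgAlice x' h → P.msgAlice x h = P.msgAlice x' h) ∧
  (∀ h y y', P.msgBob y h <+: P.msgBob y' h → P.msgBob y h = P.msgBob y' h)

/-- The distributional error under `μ`: the probability that some answerer in `A` does not
answer `f x y`. -/
noncomputable def distError [Fintype X] [Fintype Y] (P : Protocol X Y Z k first)
    (A : Set Answerer) (f : X → Y → Z) (μ : PMF (X × Y)) : ℝ :=
  prob μ {z | ¬ ∀ o ∈ A, P.output z.1 z.2 o = f z.1 z.2}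

end Protocol

/-! ### Private coin protocols -/

/-- A private coin protocol: Alice has a random `r : R`, Bob has a random `s : S`, and then they
act deterministically, each knowing the own input and the own coins only. -/
structure PrivateCoinProtocol (X Y Z R S : Type*) (k : ℕ) (first : Party) where
  /-- The law of Alice's coins. -/
  coinAlice : PMF R
  /-- The law of Bob's coins. -/
  coinBob : PMF S
  /-- What the players do, given inputs and coins. -/
  act : Protocol (X × R) (Y × S) Z k first

namespace PrivateCoinProtocol

variable {X Y Z R S : Type*} {k : ℕ} {first : Party}

/-- The joint law of the inputs `(x, y)` and the coins `(r, s)`: the inputs have law `μ`, and the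
inputs, Alice's coins and Bob's coins are independent. -/
noncomputable def law (P : PrivateCoinProtocol X Y Z R S k first) (μ : PMF (X × Y)) :
    PMF ((X × Y) × (R × S)) :=
  μ.bind fun z => P.coinAlice.bind fun r => P.coinBob.map fun s => (z, (r, s))

/-- The transcript as a random variable. -/
def randomTranscript (P : PrivateCoinProtocol X Y Z R S k first) :
    (X × Y) × (R × S) → History :=
  fun ω => P.act.transcript (ω.1.1, ω.2.1) (ω.1.2, ω.2.2)

/-- The average error under `μ`: the probability, over inputs and coins, that some answerer in
`A` does not answer `f x y`. -/
noncomputable def avgError [Fintype X] [Fintype Y] [Fintype R] [Fintype S]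
    (P : PrivateCoinProtocol X Y Z R S k first)
    (A : Set Answerer) (f : X → Y → Z) (μ : PMF (X × Y)) : ℝ :=
  prob (P.law μ)
    {ω | ¬ ∀ o ∈ A, P.act.output (ω.1.1, ω.2.1) (ω.1.2, ω.2.2) o = f ω.1.1 ω.1.2}

/-- The information cost under `μ`: the mutual information, in bits, between the pair of inputs
and the transcript. -/
noncomputable def infoCost [Fintype X] [Fintype Y] [Fintype R] [Fintype S]
    (P : PrivateCoinProtocol X Y Z R S k first) (μ : PMF (X × Y)) : ℝ :=
  mutualInfo (P.law μ) (fun ω => ω.1) P.randomTranscript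

end PrivateCoinProtocol

end TwoParty

/-! The protocol is compressed message by message. Given the history, both players know the law `q`
of the next message conditioned on the history alone; the sender also knows its law `p` conditioned
on the own input. With a shared list of independent samples from `q`, greedy rejection sampling lets
the sender name a `p`-distributed message by its position in the list. A self-delimiting code for
that position has expected length at most `2 D(p‖q) + 10`. Along a transcript `t` the ratios `p / q`
multiply to `P(t | x, y) / P(t)`, whose expected logarithm is `I(XY : T)`. So the expected total
length is at most `2 I(XY : T) + 10 k`.

The list has to be deterministic, and error and length have to be controlled together. Both follow
from minimising the single quantity failure + `lam` * bits. `exists_codebook_le_greedyCost` fixes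
the list entry by entry by conditional expectations, carrying an arbitrary additional cost `g`,
which stands for the expected cost of the remaining rounds (`exists_codebook`). A sender who picks
the position deterministically distorts the law of the inputs given what was sent. Hence the
induction over rounds, `Compressible`, allows arbitrary weights on inputs and coins and compares
with fixed prefix weights `Q`. When no rounds are left, the coins are fixed as well.

Finally `lam = 1 / b`, and the conversation is cut off after `b` bits. By Markov's inequality this
adds at most `(2 I + 10 k) / b` to the error, which for the stated budget is at most `2 ε` when `k ≥
1` and `ε < 1 / 2`. For `ε ≥ 1 / 2` the error bound is trivial. -/

namespace TwoParty

/-! ### A self-delimiting code for the natural numbers -/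

/-- Every bit is preceded by a continuation flag, and the word ends with a stop flag. -/
def selfDelimit : List Bool → Message
  | [] => [false]
  | b :: l => true :: b :: selfDelimit l

theorem selfDelimit_length (l : List Bool) : (selfDelimit l).length = 2 * l.length + 1 := by
  induction l with
  | nil => rfl
  | cons b l ih => simp only [selfDelimit, List.length_cons, ih]; ring

theorem eq_of_selfDelimit_prefix {l l' : List Bool} (h : selfDelimit l <+: selfDelimit l') :
    l = l' := by
  induction l generalizing l' with
  | nil => cases l' <;> simp_all [selfDelimit]
  | cons b l ih =>
    cases l' with
    | nil => simp [selfDelimit] at h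
    | cons b' l' =>
      simp only [selfDelimit, List.cons_prefix_cons, true_and] at h
      rw [h.1, ih h.2]

/-- The codeword of the number `n`. -/
def codeword (n : ℕ) : Message := selfDelimit n.bits

theorem eq_of_codeword_prefix {n n' : ℕ} (h : codeword n <+: codeword n') : n = n' := by
  apply Nat.digits.injective 2
  rw [Nat.digits_two_eq_bits, Nat.digits_two_eq_bits, eq_of_selfDelimit_prefix h]

theorem codeword_injective : Function.Injective codeword := fun _ _ h =>
  eq_of_codeword_prefix (h ▸ List.prefix_rfl)

theorem codeword_length_le (n : ℕ) :
    ((codeword n).length : ℝ) ≤ 2 * Real.logb 2 (n + 1) + 3 := by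
  rw [codeword, selfDelimit_length, Nat.size_eq_bits_len]
  have h1 : (2 : ℝ) ^ n.size ≤ 2 * (n + 1) := by
    rcases Nat.eq_zero_or_pos n with rfl | hn
    · simp
    · have h2 : n.size - 1 < n.size := Nat.sub_lt (Nat.size_pos.2 hn) one_pos
      have h3 := Nat.lt_size.1 h2
      have h4 : 2 ^ n.size ≤ 2 * (n + 1) := by
        have : n.size = (n.size - 1) + 1 := by omega
        rw [this, pow_succ]; omega
      exact_mod_cast h4
  have h5 : (n.size : ℝ) ≤ Real.logb 2 (2 * (n + 1)) := by
    rw [Real.le_logb_iff_rpow_le (by norm_num) (by positivity)]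
    simpa using h1
  rw [Real.logb_mul (by norm_num) (by positivity), Real.logb_self_eq_one (by norm_num)] at h5
  push_cast
  linarith

/-! ### Greedy rejection sampling with a fixed codebook -/

section Greedy

variable {M : Type*} (F : Finset M) (q p : M → ℝ)

/-- The part of `p` that is still to be produced after `j` samples from `q`, if every sample
`m` is accepted as often as `p` permits. -/
noncomputable def residual : ℕ → M → ℝ
  | 0 => p
  | j + 1 => fun m => max 0 (residual j m - (∑ m' ∈ F, residual j m') * q m)

/-- The probability that none of the first `j` samples is accepted. -/
noncomputable def residualMass (j : ℕ) : ℝ := ∑ m ∈ F, residual F q p j m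

variable {F q p}

theorem residual_succ (j : ℕ) (m : M) :
    residual F q p (j + 1) m = max 0 (residual F q p j m - residualMass F q p j * q m) := rfl

theorem residual_nonneg (hp : ∀ m, 0 ≤ p m) (j : ℕ) (m : M) : 0 ≤ residual F q p j m := by
  cases j with
  | zero => exact hp m
  | succ j => exact le_max_left _ _

theorem residualMass_nonneg (hp : ∀ m, 0 ≤ p m) (j : ℕ) : 0 ≤ residualMass F q p j :=
  Finset.sum_nonneg fun m _ => residual_nonneg hp j m

theorem residual_succ_le (hq : ∀ m, 0 ≤ q m) (hp : ∀ m, 0 ≤ p m) (j : ℕ) (m : M) :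
    residual F q p (j + 1) m ≤ residual F q p j m := by
  rw [residual_succ]
  exact max_le (residual_nonneg hp j m)
    (sub_le_self _ (mul_nonneg (residualMass_nonneg hp j) (hq m)))

theorem le_residual_succ (j : ℕ) (m : M) :
    residual F q p j m - residual F q p (j + 1) m ≤ residualMass F q p j * q m := by
  rw [residual_succ]
  linarith [le_max_right 0 (residual F q p j m - residualMass F q p j * q m)]

theorem residual_le (hq : ∀ m, 0 ≤ q m) (hp : ∀ m, 0 ≤ p m) (j : ℕ) (m : M) :
    residual F q p j m ≤ p m := by
  induction j with
  | zero => exact le_rfl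
  | succ j ih => exact (residual_succ_le hq hp j m).trans ih

theorem residualMass_succ_le (hq : ∀ m, 0 ≤ q m) (hp : ∀ m, 0 ≤ p m) (j : ℕ) :
    residualMass F q p (j + 1) ≤ residualMass F q p j :=
  Finset.sum_le_sum fun m _ => residual_succ_le hq hp j m

/-- As long as `m` is not exhausted, all earlier samples equal to `m` have been accepted. -/
theorem residual_bound (hq : ∀ m, 0 ≤ q m) (hp : ∀ m, 0 ≤ p m) (j : ℕ) (m : M)
    (h : 0 < residual F q p j m) :
    j * residualMass F q p j * q m + residual F q p j m ≤ p m := by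
  induction j with
  | zero => simp [residual]
  | succ j ih =>
    have h1 := ih (h.trans_le (residual_succ_le hq hp j m))
    have h2 : residual F q p (j + 1) m
        = residual F q p j m - residualMass F q p j * q m := by
      rw [residual_succ] at h ⊢
      rcases lt_max_iff.1 h with h | h
      · exact absurd h (lt_irrefl _)
      · exact max_eq_right h.le
    have h3 : residualMass F q p (j + 1) * q m ≤ residualMass F q p j * q m :=
      mul_le_mul_of_nonneg_right (residualMass_succ_le hq hp j) (hq m)
    have h4 : ((j : ℝ) + 1) * (residualMass F q p (j + 1) * q m)
        ≤ (j + 1) * (residualMass F q p j * q m) :=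
      mul_le_mul_of_nonneg_left h3 (by positivity)
    rw [h2]
    push_cast
    nlinarith

theorem residual_eq_zero (hp : ∀ m, 0 ≤ p m) {j : ℕ}
    (h : residualMass F q p j = 0) {m : M} (hm : m ∈ F) : residual F q p j m = 0 :=
  (Finset.sum_eq_zero_iff_of_nonneg fun m _ => residual_nonneg hp j m).1 h m hm

variable (F q p) in
/-- The expected cost of the rounds `j`, …, `j + N - 1` and of the final direct choice, if
accepting `m` in round `l` costs `c l m` and choosing `m` directly costs `c (fb m) m`. -/
noncomputable def greedyCost (fb : M → ℕ) (c : ℕ → M → ℝ) : ℕ → ℕ → ℝ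
  | 0, j => ∑ m ∈ F, residual F q p j m * c (fb m) m
  | N + 1, j => ∑ m ∈ F, (residual F q p j m - residual F q p (j + 1) m) * c j m
      + greedyCost fb c N (j + 1)

theorem greedyCost_eq_zero (hq : ∀ m, 0 ≤ q m) (hp : ∀ m, 0 ≤ p m) (fb : M → ℕ)
    (c : ℕ → M → ℝ) (N j : ℕ) (h : residualMass F q p j = 0) :
    greedyCost F q p fb c N j = 0 := by
  induction N generalizing j with
  | zero =>
    exact Finset.sum_eq_zero fun m hm => by rw [residual_eq_zero hp h hm, zero_mul]
  | succ N ih =>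
    have h1 : residualMass F q p (j + 1) = 0 :=
      le_antisymm (h ▸ residualMass_succ_le hq hp j) (residualMass_nonneg hp _)
    rw [greedyCost, ih _ h1, add_zero]
    exact Finset.sum_eq_zero fun m hm => by
      rw [residual_eq_zero hp h hm, residual_eq_zero hp h1 hm, sub_zero, zero_mul]

/-- Some cost does not exceed the weighted average. Positivity of the chosen weight matters: it
guarantees that only possible messages are ever selected. -/
theorem exists_pos_mul_le_sum {ι : Type*} (s : Finset ι) (v c : ι → ℝ) (hv : ∀ i ∈ s, 0 ≤ v i)
    (h : 0 < ∑ i ∈ s, v i) : ∃ i ∈ s, 0 < v i ∧ (∑ i ∈ s, v i) * c i ≤ ∑ i ∈ s, v i * c i := by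
  by_contra hcon
  push Not at hcon
  obtain ⟨i₀, hi₀, hpos⟩ : ∃ i ∈ s, 0 < v i := by
    by_contra h0
    push Not at h0
    exact absurd h (not_lt.2 (Finset.sum_nonpos h0))
  have h1 : ∑ i ∈ s, v i * (∑ i ∈ s, v i * c i) < ∑ i ∈ s, v i * ((∑ i ∈ s, v i) * c i) := by
    refine Finset.sum_lt_sum (fun i hi => ?_) ⟨i₀, hi₀, ?_⟩
    · rcases (hv i hi).eq_or_lt with h0 | h0
      · simp [← h0]
      · exact mul_le_mul_of_nonneg_left (hcon i hi h0).le h0.le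
    · exact mul_lt_mul_of_pos_left (hcon i₀ hi₀ hpos) hpos
  rw [← Finset.sum_mul] at h1
  refine h1.ne ?_
  rw [Finset.mul_sum]
  exact Finset.sum_congr rfl fun i _ => by ring

end Greedy

/-- One codebook that serves all inputs `i` simultaneously: if the reader of the codebook wants to
produce the law `p i`, then the weighted cost of the best entries is at most the weighted expected
cost of greedy rejection sampling. -/
theorem exists_codebook_le_greedyCost {I M : Type*} [Fintype I] (F : Finset M) (q : M → ℝ)
    (hq : ∀ m, 0 ≤ q m) (hqF : ∀ m ∈ F, 0 < q m) (hq1 : ∑ m ∈ F, q m = 1)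
    (p : I → M → ℝ) (hp : ∀ i m, 0 ≤ p i m) (c : I → ℕ → M → ℝ)
    (J : ℕ) (fb : M → ℕ) (C₀ : ℕ → M) (hfb : ∀ m, J ≤ fb m) (hC₀ : ∀ m ∈ F, C₀ (fb m) = m)
    (N j : ℕ) (hJ : j + N = J) (v : I → ℝ) (hv : ∀ i, 0 ≤ v i) :
    ∃ (C : ℕ → M) (sel : I → ℕ), (∀ i, j ≤ sel i) ∧
      (∀ i, 0 < v i * residualMass F q (p i) j → C (sel i) ∈ F ∧ 0 < p i (C (sel i))) ∧
      ∑ i, v i * residualMass F q (p i) j * c i (sel i) (C (sel i))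
        ≤ ∑ i, v i * greedyCost F q (p i) fb (c i) N j := by
  classical
  induction N generalizing j v with
  | zero =>
    obtain rfl : j = J := by omega
    have key : ∀ i, ∃ n, j ≤ n ∧
        (0 < v i * residualMass F q (p i) j → C₀ n ∈ F ∧ 0 < p i (C₀ n)) ∧
        v i * residualMass F q (p i) j * c i n (C₀ n)
          ≤ v i * greedyCost F q (p i) fb (c i) 0 j := by
      -- After the greedy rounds every message of `F` has its own entry, so each `i` can choose
      -- directly a message of positive residual that costs at most the average.
      intro i
      rcases (residualMass_nonneg (F := F) (q := q) (hp i) j).eq_or_lt with h | h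
      · refine ⟨j, le_rfl, fun h' => ?_, ?_⟩
        · simp [← h] at h'
        · rw [← h, greedyCost_eq_zero hq (hp i) _ _ _ _ h.symm]; simp
      · obtain ⟨m, hm, hpos, hle⟩ := exists_pos_mul_le_sum F (residual F q (p i) j)
          (fun m => c i (fb m) m) (fun m _ => residual_nonneg (hp i) j m) h
        refine ⟨fb m, hfb m, fun _ => ?_, ?_⟩
        · rw [hC₀ m hm]
          exact ⟨hm, hpos.trans_le (residual_le hq (hp i) j m)⟩
        · rw [hC₀ m hm, mul_assoc]
          exact mul_le_mul_of_nonneg_left hle (hv i)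
    choose sel h1 h2 h3 using key
    exact ⟨C₀, sel, h1, h2, Finset.sum_le_sum fun i _ => h3 i⟩
  | succ N ih =>
    set t : I → ℝ := fun i => residualMass F q (p i) j with ht
    set t' : I → ℝ := fun i => residualMass F q (p i) (j + 1) with ht'
    set b : I → M → ℝ := fun i m => residual F q (p i) j m - residual F q (p i) (j + 1) m with hb
    have ht0 : ∀ i, 0 ≤ t i := fun i => residualMass_nonneg (hp i) _
    have ht'0 : ∀ i, 0 ≤ t' i := fun i => residualMass_nonneg (hp i) _
    have hb0 : ∀ i m, 0 ≤ b i m := fun i m => sub_nonneg.2 (residual_succ_le hq (hp i) j m)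
    have hbt : ∀ i m, b i m ≤ t i * q m := fun i m => le_residual_succ j m
    have hsum : ∀ i, ∑ m ∈ F, (t i * q m - b i m) = t' i := by
      intro i
      rw [Finset.sum_sub_distrib, ← Finset.mul_sum, hq1, hb, Finset.sum_sub_distrib]
      simp only [ht, ht', residualMass]; ring
    -- If entry `j` is `m`, then `i` accepts it with probability `b i m / (t i * q m)`. The rejected
    -- part of the weight `v i * t i` is written as `v' m i * t' i`, the form that the induction
    -- hypothesis needs; averaged over `m` with law `q`, `v' m i` is again `v i` unless `t' i = 0`.
    set v' : M → I → ℝ := fun m i => v i * (t i * q m - b i m) / (q m * t' i) with hv'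
    have hv'0 : ∀ m i, 0 ≤ v' m i := fun m i =>
      div_nonneg (mul_nonneg (hv i) (sub_nonneg.2 (hbt i m))) (mul_nonneg (hq m) (ht'0 i))
    have hsplit : ∀ m ∈ F, ∀ i, v i * t i = v i * b i m / q m + v' m i * t' i := by
      intro m hm i
      have hqm := (hqF m hm).ne'
      rcases (ht'0 i).eq_or_lt with h | h
      · have h0 : t i * q m - b i m = 0 :=
          (Finset.sum_eq_zero_iff_of_nonneg fun m _ => sub_nonneg.2 (hbt i m)).1
            ((hsum i).trans h.symm) m hm
        rw [← h, mul_zero, add_zero, eq_div_iff hqm]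
        linear_combination v i * h0
      · have := h.ne'
        simp only [hv']
        field_simp
        ring
    have havg : ∀ i, (∑ m ∈ F, q m * v' m i) * greedyCost F q (p i) fb (c i) N (j + 1)
        = v i * greedyCost F q (p i) fb (c i) N (j + 1) := by
      intro i
      rcases (ht'0 i).eq_or_lt with h | h
      · rw [greedyCost_eq_zero hq (hp i) _ _ _ _ h.symm, mul_zero, mul_zero]
      · congr 1
        have : ∀ m ∈ F, q m * v' m i = v i / t' i * (t i * q m - b i m) := by
          intro m hm
          have hqm := (hqF m hm).ne'
          have := h.ne'
          simp only [hv']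
          field_simp
        rw [Finset.sum_congr rfl this, ← Finset.mul_sum, hsum, div_mul_cancel₀ _ h.ne']
    set H : M → ℝ := fun m => ∑ i, (v i * b i m / q m * c i j m
      + v' m i * greedyCost F q (p i) fb (c i) N (j + 1)) with hH
    have hHavg : ∑ m ∈ F, q m * H m = ∑ i, v i * greedyCost F q (p i) fb (c i) (N + 1) j := by
      simp only [hH, Finset.mul_sum]
      rw [Finset.sum_comm]
      refine Finset.sum_congr rfl fun i _ => ?_
      rw [greedyCost, mul_add, ← havg i, Finset.mul_sum, Finset.sum_mul, ← Finset.sum_add_distrib]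
      refine Finset.sum_congr rfl fun m hm => ?_
      have hqm := (hqF m hm).ne'
      simp only [hb]
      field_simp
    -- Conditional expectations: `H m` is the expected cost once entry `j` is fixed to `m`, so some
    -- `m` does no worse than the average.
    obtain ⟨m, hm, -, hmH⟩ := exists_pos_mul_le_sum F q H (fun m _ => hq m)
      (by rw [hq1]; exact one_pos)
    rw [hq1, one_mul, hHavg] at hmH
    obtain ⟨C, sel, hsel, hselp, hle⟩ := ih (j + 1) (by omega) (v' m) (hv'0 m)
    have hA0 : ∀ i, 0 ≤ v i * b i m / q m := fun i =>
      div_nonneg (mul_nonneg (hv i) (hb0 i m)) (hq m)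
    have hB0 : ∀ i, 0 ≤ v' m i * t' i := fun i => mul_nonneg (hv'0 m i) (ht'0 i)
    have hCsel : ∀ i, Function.update C j m (sel i) = C (sel i) := fun i =>
      Function.update_of_ne (by have := hsel i; omega) _ _
    -- Randomised acceptance is replaced by the cheaper of the two options, accepting entry `j` or
    -- keeping the later choice `sel i`, among those of positive weight.
    have key : ∀ i, ∃ n, j ≤ n ∧ (0 < v i * t i →
        Function.update C j m n ∈ F ∧ 0 < p i (Function.update C j m n)) ∧
        v i * t i * c i n (Function.update C j m n) ≤ v i * b i m / q m * c i j m
          + v' m i * t' i * c i (sel i) (C (sel i)) := by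
      intro i
      have hpos : 0 < v i * b i m / q m → 0 < p i m := by
        intro h
        have h1 : b i m ≠ 0 := by rintro h1; simp [h1] at h
        have h2 : b i m ≤ p i m := by
          have := residual_nonneg (F := F) (q := q) (hp i) (j + 1) m
          have := residual_le (F := F) hq (hp i) j m
          simp only [hb]; linarith
        exact ((hb0 i m).lt_of_ne' h1).trans_le h2
      rcases (hB0 i).eq_or_lt with hB | hB
      · refine ⟨j, le_rfl, ?_, ?_⟩
        · rw [Function.update_self, hsplit m hm i, ← hB, add_zero]
          exact fun h => ⟨hm, hpos h⟩
        · rw [Function.update_self, hsplit m hm i, ← hB, zero_mul, add_zero]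
          simp
      · by_cases hlt : 0 < v i * b i m / q m ∧ c i j m ≤ c i (sel i) (C (sel i))
        · refine ⟨j, le_rfl, fun _ => ?_, ?_⟩
          · rw [Function.update_self]; exact ⟨hm, hpos hlt.1⟩
          · rw [Function.update_self, hsplit m hm i, add_mul]
            gcongr
            exact hlt.2
        · refine ⟨sel i, by have := hsel i; omega, fun _ => ?_, ?_⟩
          · rw [hCsel]; exact hselp i hB
          · rw [hCsel, hsplit m hm i, add_mul]
            rcases (hA0 i).eq_or_lt with hA | hA
            · rw [← hA, zero_mul, zero_mul]
            · have : c i (sel i) (C (sel i)) ≤ c i j m := by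
                by_contra hcon
                exact hlt ⟨hA, (not_le.1 hcon).le⟩
              gcongr
    choose n h1 h2 h3 using key
    refine ⟨Function.update C j m, n, h1, h2, (Finset.sum_le_sum fun i _ => h3 i).trans ?_⟩
    refine le_trans ?_ hmH
    simp only [hH, Finset.sum_add_distrib]
    gcongr

/-! ### The expected length of the codeword chosen by greedy rejection sampling -/

section Length

variable {M : Type*} {F : Finset M} {q p : M → ℝ}

theorem residualMass_le_one (hq : ∀ m, 0 ≤ q m) (hp : ∀ m, 0 ≤ p m) (hp1 : ∑ m ∈ F, p m = 1)
    (j : ℕ) : residualMass F q p j ≤ 1 := by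
  rw [← hp1]
  exact Finset.sum_le_sum fun m _ => residual_le hq hp j m

/-- The integral of `logb 2 (1 / s)` over `0 ≤ s ≤ t`. -/
noncomputable def logPotential (t : ℝ) : ℝ := t * (1 - Real.log t) / Real.log 2

theorem logPotential_nonneg {t : ℝ} (h0 : 0 ≤ t) (h1 : t ≤ 1) : 0 ≤ logPotential t :=
  div_nonneg (mul_nonneg h0 (by linarith [Real.log_nonpos h0 h1])) (Real.log_nonneg one_le_two)

/-- As `logb 2 (1 / s)` decreases in `s`, its value at the right end `t` is its minimum on `[t',
t]`. Summed over the rounds, this bounds the expected logarithm of one over the residual mass by an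
integral. -/
theorem sub_mul_neg_logb_le {t t' : ℝ} (h0 : 0 ≤ t') (h1 : t' ≤ t) :
    (t - t') * -Real.logb 2 t ≤ logPotential t - logPotential t' := by
  have h2 : (t - t') * -Real.log t ≤ t * (1 - Real.log t) - t' * (1 - Real.log t') := by
    rcases h0.eq_or_lt with rfl | h0
    · simp; nlinarith
    · have ht := h0.trans_le h1
      have h3 : Real.log (t / t') ≤ t / t' - 1 := Real.log_le_sub_one_of_pos (by positivity)
      rw [Real.log_div ht.ne' h0.ne'] at h3
      have h4 := mul_le_mul_of_nonneg_left h3 h0.le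
      have h5 : t' * (t / t' - 1) = t - t' := by field_simp
      linarith
  have h6 : 0 < Real.log 2 := Real.log_pos one_lt_two
  rw [logPotential, logPotential, ← sub_div, Real.logb, ← neg_div, ← mul_div_assoc]
  gcongr

/-- The codeword of a round in which `m` may still be accepted is short. -/
theorem codeword_length_le_of_residual_pos (hq : ∀ m, 0 ≤ q m) (hp : ∀ m, 0 ≤ p m)
    (hp1 : ∑ m ∈ F, p m = 1) {j : ℕ} {m : M} (hmF : m ∈ F) (hqm : 0 < q m)
    (h : 0 < residual F q p j m) :
    ((codeword j).length : ℝ)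
      ≤ 2 * Real.logb 2 (1 + p m / q m) + 3 + 2 * -Real.logb 2 (residualMass F q p j) := by
  have ht : 0 < residualMass F q p j := h.trans_le
    (Finset.single_le_sum (f := residual F q p j) (fun m _ => residual_nonneg hp j m) hmF)
  have ht1 := residualMass_le_one (F := F) hq hp hp1 j
  have hpm := hp m
  have h1 : j * residualMass F q p j ≤ p m / q m := by
    rw [le_div_iff₀ hqm]
    linarith [residual_bound hq hp j m h]
  have h2 : (j : ℝ) + 1 ≤ (1 + p m / q m) / residualMass F q p j := by
    rw [le_div_iff₀ ht]
    linarith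
  have h3 : Real.logb 2 (j + 1)
      ≤ Real.logb 2 ((1 + p m / q m) / residualMass F q p j) :=
    Real.logb_le_logb_of_le one_lt_two (by positivity) h2
  rw [Real.logb_div (by positivity) ht.ne'] at h3
  linarith [codeword_length_le j]

/-- The part of the length bound that depends on `p m / q m` telescopes over the rounds, the part
`-logb 2 t` is absorbed by the decrease of `logPotential`, and `τ` pays for the final direct choice.
-/
theorem greedyCost_le (hq : ∀ m, 0 ≤ q m) (hqF : ∀ m ∈ F, 0 < q m) (hp : ∀ m, 0 ≤ p m)
    (hp1 : ∑ m ∈ F, p m = 1) (lam : ℝ) (hlam : 0 ≤ lam) (g : M → ℝ) (fb : M → ℕ) (τ : ℝ)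
    (N j : ℕ)
    (hτ : ∑ m ∈ F, residual F q p (j + N) m * ((codeword (fb m)).length : ℝ) ≤ τ) :
    greedyCost F q p fb (fun l m => lam * ((codeword l).length : ℝ) + g m) N j
      ≤ ∑ m ∈ F, residual F q p j m * (lam * (2 * Real.logb 2 (1 + p m / q m) + 3) + g m)
        + lam * (2 * logPotential (residualMass F q p j)) + lam * τ := by
  induction N generalizing j with
  | zero =>
    have h1 := mul_le_mul_of_nonneg_left hτ hlam
    have h2 : 0 ≤ lam * (2 * logPotential (residualMass F q p j)) :=
      mul_nonneg hlam (mul_nonneg two_pos.le (logPotential_nonneg (residualMass_nonneg hp j)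
        (residualMass_le_one hq hp hp1 j)))
    have h3 : 0 ≤ ∑ m ∈ F, residual F q p j m * (lam * (2 * Real.logb 2 (1 + p m / q m) + 3)) := by
      refine Finset.sum_nonneg fun m hm => mul_nonneg (residual_nonneg hp j m)
        (mul_nonneg hlam ?_)
      have := Real.logb_nonneg one_lt_two
        (le_add_of_nonneg_right (div_nonneg (hp m) (hq m)) : (1 : ℝ) ≤ 1 + p m / q m)
      positivity
    rw [Finset.mul_sum] at h1
    simp only [greedyCost, mul_add, Finset.sum_add_distrib, add_zero] at h1 h2 h3 ⊢
    have h4 : ∑ m ∈ F, residual F q p j m * (lam * ((codeword (fb m)).length : ℝ))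
        = ∑ m ∈ F, lam * (residual F q p j m * ((codeword (fb m)).length : ℝ)) :=
      Finset.sum_congr rfl fun m _ => by ring
    linarith
  | succ N ih =>
    have h1 := ih (j + 1) (by rwa [add_assoc, add_comm 1 N])
    set t := residualMass F q p j
    have h2 := sub_mul_neg_logb_le (residualMass_nonneg (F := F) (q := q) hp (j + 1))
      (residualMass_succ_le hq hp j)
    have h3 : ∑ m ∈ F, (residual F q p j m - residual F q p (j + 1) m)
          * (lam * ((codeword j).length : ℝ) + g m)
        ≤ ∑ m ∈ F, (residual F q p j m - residual F q p (j + 1) m)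
          * (lam * (2 * Real.logb 2 (1 + p m / q m) + 3 + 2 * -Real.logb 2 t) + g m) := by
      refine Finset.sum_le_sum fun m hm => ?_
      have hb := sub_nonneg.2 (residual_succ_le (F := F) hq hp j m)
      rcases hb.eq_or_lt with h0 | h0
      · rw [← h0, zero_mul, zero_mul]
      · have := codeword_length_le_of_residual_pos hq hp hp1 hm (hqF m hm)
          (lt_of_lt_of_le h0 (sub_le_self _ (residual_nonneg hp (j + 1) m)))
        gcongr
    have h4 : ∑ m ∈ F, (residual F q p j m - residual F q p (j + 1) m)
          * (lam * (2 * Real.logb 2 (1 + p m / q m) + 3 + 2 * -Real.logb 2 t) + g m)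
        = ∑ m ∈ F, residual F q p j m * (lam * (2 * Real.logb 2 (1 + p m / q m) + 3) + g m)
          - ∑ m ∈ F, residual F q p (j + 1) m
              * (lam * (2 * Real.logb 2 (1 + p m / q m) + 3) + g m)
          + lam * (2 * ((t - residualMass F q p (j + 1)) * -Real.logb 2 t)) := by
      have : t - residualMass F q p (j + 1)
          = ∑ m ∈ F, (residual F q p j m - residual F q p (j + 1) m) :=
        (Finset.sum_sub_distrib _ _).symm
      rw [this, ← Finset.sum_sub_distrib, Finset.sum_mul, Finset.mul_sum, Finset.mul_sum,
        ← Finset.sum_add_distrib]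
      exact Finset.sum_congr rfl fun m _ => by ring
    have h5 : lam * (2 * ((t - residualMass F q p (j + 1)) * -Real.logb 2 t))
        ≤ lam * (2 * (logPotential t - logPotential (residualMass F q p (j + 1)))) := by
      gcongr
    rw [greedyCost]
    linarith

/-- The expected value of `logb 2 (1 + p / q)` exceeds the relative entropy by at most
`1 / log 2`. -/
theorem sum_mul_logb_one_add_le (hqF : ∀ m ∈ F, 0 < q m) (hq1 : ∑ m ∈ F, q m = 1)
    (hp : ∀ m, 0 ≤ p m) :
    ∑ m ∈ F, p m * Real.logb 2 (1 + p m / q m)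
      ≤ ∑ m ∈ F, p m * Real.logb 2 (p m / q m) + 1 / Real.log 2 := by
  have h2 : 0 < Real.log 2 := Real.log_pos one_lt_two
  have hr : 1 / Real.log 2 = ∑ m ∈ F, q m / Real.log 2 := by rw [← Finset.sum_div, hq1]
  rw [hr, ← Finset.sum_add_distrib]
  refine Finset.sum_le_sum fun m hm => ?_
  have hqm := hqF m hm
  rcases (hp m).eq_or_lt with h0 | h0
  · rw [← h0, zero_mul, zero_mul, zero_add]; positivity
  · have h3 : 1 + p m / q m = p m / q m * (1 + q m / p m) := by field_simp; ring
    rw [h3, Real.logb_mul (by positivity) (by positivity), mul_add]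
    gcongr
    have h4 : Real.log (1 + q m / p m) ≤ q m / p m := by
      linarith [Real.log_le_sub_one_of_pos (by positivity : 0 < 1 + q m / p m)]
    have h5 := mul_le_mul_of_nonneg_left h4 h0.le
    rw [mul_div_cancel₀ _ h0.ne'] at h5
    rw [Real.logb, ← mul_div_assoc]
    gcongr

end Length

/-! ### Codebooks with codeword lengths controlled by relative entropy -/

/-- Codeword lengths grow logarithmically. With `r` the least value of `q` and `K` the number of
messages, this makes the direct choice after `J` greedy rounds cost at most one bit on average. -/
theorem exists_codeword_length_le_mul (K : ℕ) {r : ℝ} (hr : 0 < r) :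
    ∃ J : ℕ, ∀ n < J + K, ((codeword n).length : ℝ) ≤ r * J := by
  have h2 : 0 < Real.log 2 := Real.log_pos one_lt_two
  have h := (Real.isLittleO_log_id_atTop.bound
    (show 0 < r * Real.log 2 / 8 by positivity)).natCast_atTop
  obtain ⟨J₀, hJ₀⟩ := Filter.eventually_atTop.1 h
  obtain ⟨J₁, hJ₁⟩ := exists_nat_gt (6 / r)
  -- `J ≥ 6 / r` bounds the constant `3` by `r * J / 2`; `J ≥ K` and the factor `1 / 8` bound the
  -- logarithmic term by `r * J / 2`.
  refine ⟨J₀ + J₁ + K + 1, fun n hn => ?_⟩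
  set J := J₀ + J₁ + K + 1 with hJ
  have h3 := hJ₀ (J + K) (by omega)
  simp only [id, Real.norm_eq_abs] at h3
  have hKJ : (K : ℝ) ≤ J := by exact_mod_cast (by omega : K ≤ J)
  have hJ1 : 6 / r ≤ J := hJ₁.le.trans (by exact_mod_cast (by omega : J₁ ≤ J))
  rw [div_le_iff₀ hr] at hJ1
  have h4 : Real.log ((J + K : ℕ) : ℝ) ≤ r * Real.log 2 / 8 * (2 * J) := by
    refine (le_abs_self _).trans (h3.trans ?_)
    rw [abs_of_nonneg (by positivity)]
    gcongr
    push_cast; linarith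
  have h5 : Real.logb 2 (n + 1) ≤ Real.logb 2 ((J + K : ℕ) : ℝ) :=
    Real.logb_le_logb_of_le one_lt_two (by positivity) (by exact_mod_cast hn)
  have h6 : Real.logb 2 ((J + K : ℕ) : ℝ) ≤ r * J / 4 := by
    rw [Real.logb, div_le_iff₀ h2]; linarith
  linarith [codeword_length_le n]

theorem exists_codebook_of_normalized {I M : Type*} [Fintype I] (F : Finset M) (q : M → ℝ)
    (hq : ∀ m, 0 ≤ q m) (hqF : ∀ m ∈ F, 0 < q m) (hq1 : ∑ m ∈ F, q m = 1)
    (p : I → M → ℝ) (hp : ∀ i m, 0 ≤ p i m) (hp1 : ∀ i, ∑ m ∈ F, p i m = 1)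
    (V : I → ℝ) (hV : ∀ i, 0 ≤ V i) (lam : ℝ) (hlam : 0 ≤ lam) (g : I → M → ℝ) :
    ∃ (C : ℕ → M) (sel : I → ℕ),
      (∀ i, 0 < V i → C (sel i) ∈ F ∧ 0 < p i (C (sel i))) ∧
      ∑ i, V i * (lam * ((codeword (sel i)).length : ℝ) + g i (C (sel i)))
        ≤ ∑ i, V i * ∑ m ∈ F, p i m * (lam * (2 * Real.logb 2 (p i m / q m) + 10) + g i m) := by
  classical
  obtain ⟨m₀, hm₀⟩ : F.Nonempty := by
    by_contra h
    rw [Finset.not_nonempty_iff_eq_empty] at h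
    simp [h] at hq1
  obtain ⟨m₁, hm₁, hmin⟩ := F.exists_min_image q ⟨m₀, hm₀⟩
  obtain ⟨J, hJ⟩ := exists_codeword_length_le_mul F.card (hqF m₁ hm₁)
  set fb : M → ℕ := fun m => J + (if m ∈ F then F.toList.idxOf m else 0) with hfb
  set C₀ : ℕ → M := fun n => F.toList.getD (n - J) m₀ with hC₀
  have hidx : ∀ m ∈ F, F.toList.idxOf m < F.toList.length := fun m hm =>
    List.idxOf_lt_length_iff.2 (Finset.mem_toList.2 hm)
  have hC₀fb : ∀ m ∈ F, C₀ (fb m) = m := by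
    intro m hm
    simp only [hC₀, hfb, if_pos hm, Nat.add_sub_cancel_left]
    rw [List.getD_eq_getElem _ _ (hidx m hm), List.getElem_idxOf]
  have hmass0 : ∀ i, residualMass F q (p i) 0 = 1 := hp1
  obtain ⟨C, sel, -, h1, h2⟩ := exists_codebook_le_greedyCost F q hq hqF hq1 p hp
    (fun i l m => lam * ((codeword l).length : ℝ) + g i m) J fb C₀
    (fun m => Nat.le_add_right _ _) hC₀fb J 0 (zero_add J) V hV
  simp only [hmass0, mul_one] at h1 h2
  refine ⟨C, sel, h1, h2.trans (Finset.sum_le_sum fun i _ => mul_le_mul_of_nonneg_left ?_ (hV i))⟩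
  have hfblen : ∀ m ∈ F, ((codeword (fb m)).length : ℝ) ≤ q m₁ * J := by
    intro m hm
    refine hJ _ ?_
    simp only [hfb, if_pos hm]
    have := hidx m hm
    rw [Finset.length_toList] at this
    omega
  have hτ : ∑ m ∈ F, residual F q (p i) (0 + J) m * ((codeword (fb m)).length : ℝ) ≤ 1 := by
    rw [zero_add]
    refine (Finset.sum_le_sum fun m hm => mul_le_mul_of_nonneg_left (hfblen m hm)
      (residual_nonneg (hp i) J m)).trans ?_
    rw [← Finset.sum_mul]
    change residualMass F q (p i) J * _ ≤ 1
    rcases (residualMass_nonneg (F := F) (q := q) (hp i) J).eq_or_lt with h0 | h0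
    · rw [← h0, zero_mul]; exact zero_le_one
    · obtain ⟨m, hm, hpos⟩ : ∃ m ∈ F, 0 < residual F q (p i) J m := by
        by_contra hcon
        push Not at hcon
        exact absurd h0 (not_lt.2 (Finset.sum_nonpos hcon))
      -- A message still unexhausted after `J` rounds has `J * t * q m ≤ p i m ≤ 1`, where `t` is
      -- the residual mass, and `q m₁ ≤ q m`.
      have h3 := residual_bound hq (hp i) J m hpos
      have h4 : p i m ≤ 1 := hp1 i ▸ Finset.single_le_sum (fun m _ => hp i m) hm
      have h5 : residualMass F q (p i) J * (q m₁ * J) ≤ residualMass F q (p i) J * (q m * J) := by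
        have := hmin m hm
        gcongr
      linarith
  refine (greedyCost_le hq hqF (hp i) (hp1 i) lam hlam (g i) fb 1 J 0 hτ).trans ?_
  -- The constant is `3 + 1 + 4 / log 2 ≤ 10`: code overhead, direct choice, and `2 / log 2` each
  -- from `1 + p / q` and from the potential.
  have h6 := sum_mul_logb_one_add_le hqF hq1 (hp i)
  have h7 : (1 : ℝ) / Real.log 2 ≤ 3 / 2 := by
    rw [div_le_div_iff₀ (Real.log_pos one_lt_two) two_pos]
    linarith [Real.log_two_gt_d9]
  have h8 : logPotential (residualMass F q (p i) 0) = 1 / Real.log 2 := by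
    rw [hmass0, logPotential]; simp
  have h9 : ∀ (u : M → ℝ) (d : ℝ), ∑ m ∈ F, p i m * (lam * (2 * u m + d) + g i m)
      = lam * (2 * ∑ m ∈ F, p i m * u m + d) + ∑ m ∈ F, p i m * g i m := by
    intro u d
    have : d = d * ∑ m ∈ F, p i m := by rw [hp1, mul_one]
    conv_rhs => rw [this]
    simp only [mul_add, Finset.sum_add_distrib, Finset.mul_sum]
    congr 2 <;> exact Finset.sum_congr rfl fun m _ => by ring
  rw [h8]
  simp only [residual]
  rw [h9 (fun m => Real.logb 2 (1 + p i m / q m)) 3,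
    h9 (fun m => Real.logb 2 (p i m / q m)) 10]
  nlinarith

/-- A codebook for all inputs `i` at once: entry `sel i` is a possible value of the law `p i`, and
on average the length of its codeword is controlled by the relative entropy of `p i` and `q`,
while the additional cost `g` is the same as that of a random sample from `p i`. -/
theorem exists_codebook {I M : Type*} [Fintype I] [Nonempty M] (F : Finset M) (q : M → ℝ)
    (hqF : ∀ m ∈ F, 0 < q m) (hq1 : ∑ m ∈ F, q m ≤ 1)
    (V : I → ℝ) (hV : ∀ i, 0 ≤ V i) (p : I → M → ℝ)
    (hp : ∀ i, 0 < V i → ∀ m, 0 ≤ p i m) (hp1 : ∀ i, 0 < V i → ∑ m ∈ F, p i m = 1)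
    (lam : ℝ) (hlam : 0 ≤ lam) (g : I → M → ℝ) :
    ∃ (C : ℕ → M) (sel : I → ℕ),
      (∀ i, 0 < V i → C (sel i) ∈ F ∧ 0 < p i (C (sel i))) ∧
      ∑ i, V i * (lam * ((codeword (sel i)).length : ℝ) + g i (C (sel i)))
        ≤ ∑ i, V i * ∑ m ∈ F, p i m * (lam * (2 * Real.logb 2 (p i m / q m) + 10) + g i m) := by
  classical
  by_cases hne : ∃ i, 0 < V i
  · obtain ⟨i₀, hi₀⟩ := hne
    obtain ⟨m₀, hm₀⟩ : F.Nonempty := by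
      by_contra h
      rw [Finset.not_nonempty_iff_eq_empty] at h
      have := hp1 i₀ hi₀
      simp [h] at this
    have hs : 0 < ∑ m ∈ F, q m := Finset.sum_pos hqF ⟨m₀, hm₀⟩
    set s := ∑ m ∈ F, q m
    -- Normalising only increases `q` on `F`, hence only decreases the logarithms. Indices of weight
    -- zero get the dummy law `q'`.
    set q' : M → ℝ := fun m => if m ∈ F then q m / s else 0 with hq'
    have hq'0 : ∀ m, 0 ≤ q' m := by
      intro m
      simp only [hq']
      split_ifs with h
      · exact div_nonneg (hqF m h).le hs.le
      · exact le_rfl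
    have hq'F : ∀ m ∈ F, q' m = q m / s := fun m hm => if_pos hm
    have hq'1 : ∑ m ∈ F, q' m = 1 := by
      rw [Finset.sum_congr rfl hq'F, ← Finset.sum_div, div_self hs.ne']
    set p' : I → M → ℝ := fun i => if 0 < V i then p i else q' with hp'
    have hp'V : ∀ i, 0 < V i → p' i = p i := fun i hi => if_pos hi
    obtain ⟨C, sel, h1, h2⟩ := exists_codebook_of_normalized F q' hq'0
      (fun m hm => by rw [hq'F m hm]; exact div_pos (hqF m hm) hs) hq'1 p'
      (fun i m => by
        by_cases hi : 0 < V i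
        · rw [hp'V i hi]; exact hp i hi m
        · simp only [hp', if_neg hi]; exact hq'0 m)
      (fun i => by
        by_cases hi : 0 < V i
        · rw [hp'V i hi]; exact hp1 i hi
        · simp only [hp', if_neg hi]; exact hq'1) V hV lam hlam g
    refine ⟨C, sel, fun i hi => hp'V i hi ▸ h1 i hi, h2.trans (Finset.sum_le_sum fun i _ => ?_)⟩
    rcases (hV i).eq_or_lt with h0 | h0
    · rw [← h0, zero_mul, zero_mul]
    · refine mul_le_mul_of_nonneg_left (Finset.sum_le_sum fun m hm => ?_) h0.le
      rw [hp'V i h0]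
      have hqm := hqF m hm
      rcases (hp i h0 m).eq_or_lt with h3 | h3
      · rw [← h3, zero_mul, zero_mul]
      · have h4 : Real.logb 2 (p i m / q' m) ≤ Real.logb 2 (p i m / q m) := by
          have hle : q m ≤ q' m := by
            rw [hq'F m hm, le_div_iff₀ hs]
            exact mul_le_of_le_one_right hqm.le hq1
          exact Real.logb_le_logb_of_le one_lt_two (div_pos h3 (hqm.trans_le hle)) (by gcongr)
        gcongr
  · push Not at hne
    have h0 : ∀ i, V i = 0 := fun i => le_antisymm (hne i) (hV i)
    exact ⟨fun _ => Classical.arbitrary M, fun _ => 0, by simp [h0], by simp [h0]⟩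

/-! ### Splitting off the first message -/

@[simp] theorem Party.other_other (a : Party) : a.other.other = a := by cases a <;> rfl

theorem speaker_zero (first : Party) : speaker first 0 = first := by simp [speaker]

theorem speaker_succ (first : Party) (i : ℕ) :
    speaker first (i + 1) = speaker first.other i := by
  unfold speaker
  by_cases h : Even i
  · rw [if_pos h, if_neg (by simpa [Nat.even_add_one] using h)]
  · rw [if_neg h, if_pos (by simpa [Nat.even_add_one] using h), Party.other_other]

theorem speaker_other (first : Party) (i : ℕ) :
    speaker first.other i = (speaker first i).other := by
  unfold speaker
  split_ifs <;> simp

namespace Protocol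

variable {X Y Z : Type*} {k : ℕ} {first : Party}

/-- The rest of a protocol after the first message `m`. -/
def tail (P : Protocol X Y Z (k + 1) first) (m : Message) : Protocol X Y Z k first.other where
  msgAlice x h := P.msgAlice x (m :: h)
  msgBob y h := P.msgBob y (m :: h)
  outAlice x h := P.outAlice x (m :: h)
  outBob y h := P.outBob y (m :: h)
  outTranscript h := P.outTranscript (m :: h)

theorem history_succ_eq_cons (P : Protocol X Y Z (k + 1) first) (x : X) (y : Y) (i : ℕ) :
    P.history x y (i + 1)
      = P.msg x y [] first :: (P.tail (P.msg x y [] first)).history x y i := by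
  induction i with
  | zero => simp [history, speaker_zero]
  | succ i ih =>
    rw [history, ih, history, speaker_succ]
    cases speaker first.other i <;> rfl

theorem transcript_eq_cons (P : Protocol X Y Z (k + 1) first) (x : X) (y : Y) :
    P.transcript x y
      = P.msg x y [] first :: (P.tail (P.msg x y [] first)).transcript x y :=
  P.history_succ_eq_cons x y k

theorem output_eq_tail (P : Protocol X Y Z (k + 1) first) (x : X) (y : Y) (o : Answerer) :
    P.output x y o = (P.tail (P.msg x y [] first)).output x y o := by
  cases o <;> simp [output, transcript_eq_cons, tail]

theorem bits_eq_tail (P : Protocol X Y Z (k + 1) first) (x : X) (y : Y) :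
    P.bits x y = (P.msg x y [] first).length + (P.tail (P.msg x y [] first)).bits x y := by
  simp [bits, transcript_eq_cons]

theorem history_length (P : Protocol X Y Z k first) (x : X) (y : Y) (i : ℕ) :
    (P.history x y i).length = i := by
  induction i with
  | zero => rfl
  | succ i ih => simp [history, ih]

theorem transcript_length (P : Protocol X Y Z k first) (x : X) (y : Y) :
    (P.transcript x y).length = k := P.history_length x y k

/-- The protocol in which Alice sends `c x` first, and the players continue with the protocol
`rest` belonging to that message. -/
def consAlice (c : X → Message) (rest : Message → Protocol X Y Z k .bob) :
    Protocol X Y Z (k + 1) .alice where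
  msgAlice x h := match h with
    | [] => c x
    | m :: h => (rest m).msgAlice x h
  msgBob y h := match h with
    | [] => []
    | m :: h => (rest m).msgBob y h
  outAlice x h := match h with
    | [] => (rest []).outAlice x []
    | m :: h => (rest m).outAlice x h
  outBob y h := match h with
    | [] => (rest []).outBob y []
    | m :: h => (rest m).outBob y h
  outTranscript h := match h with
    | [] => (rest []).outTranscript []
    | m :: h => (rest m).outTranscript h

theorem tail_consAlice (c : X → Message) (rest : Message → Protocol X Y Z k .bob)
    (m : Message) : (consAlice c rest).tail m = rest m := rfl

theorem prefixFree_consAlice {c : X → Message} {rest : Message → Protocol X Y Z k .bob}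
    (hc : ∀ x x', c x <+: c x' → c x = c x') (hr : ∀ m, (rest m).PrefixFree) :
    (consAlice c rest).PrefixFree := by
  refine ⟨fun h x x' => ?_, fun h y y' => ?_⟩
  · cases h with
    | nil => exact hc x x'
    | cons m h => exact (hr m).1 h x x'
  · cases h with
    | nil => exact fun _ => rfl
    | cons m h => exact (hr m).2 h y y'

/-! ### Exchanging the roles of the players -/

/-- The protocol with the names of the players exchanged. -/
def swap (P : Protocol X Y Z k first) : Protocol Y X Z k first.other where
  msgAlice := P.msgBob
  msgBob := P.msgAlice
  outAlice := P.outBob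
  outBob := P.outAlice
  outTranscript := P.outTranscript

end Protocol

/-- The answerer after exchanging the names of the players. -/
def Answerer.swap : Answerer → Answerer
  | .alice => .bob
  | .bob => .alice
  | .transcript => .transcript

@[simp] theorem Answerer.swap_swap (o : Answerer) : o.swap.swap = o := by cases o <;> rfl

namespace Protocol

variable {X Y Z : Type*} {k : ℕ} {first : Party}

theorem history_swap (P : Protocol X Y Z k first) (x : X) (y : Y) (i : ℕ) :
    P.swap.history y x i = P.history x y i := by
  induction i with
  | zero => rfl
  | succ i ih =>
    rw [history, history, ih, speaker_other]
    cases speaker first i <;> rfl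

theorem transcript_swap (P : Protocol X Y Z k first) (x : X) (y : Y) :
    P.swap.transcript y x = P.transcript x y := P.history_swap x y k

theorem output_swap (P : Protocol X Y Z k first) (x : X) (y : Y) (o : Answerer) :
    P.swap.output y x o = P.output x y o.swap := by
  cases o <;> simp only [output, transcript_swap, Answerer.swap] <;> rfl

theorem bits_swap (P : Protocol X Y Z k first) (x : X) (y : Y) :
    P.swap.bits y x = P.bits x y := by
  rw [bits, bits, transcript_swap]

/-! ### The loss of a protocol -/

open Classical in
/-- The indicator of the event that some answerer in `A` is wrong. -/
noncomputable def failure (P : Protocol X Y Z k first) (A : Set Answerer) (f : X → Y → Z)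
    (x : X) (y : Y) : ℝ :=
  if ∀ o ∈ A, P.output x y o = f x y then 0 else 1

theorem failure_congr {X' Y' Z' : Type*} {k' : ℕ} {first' : Party} {P : Protocol X Y Z k first}
    {P' : Protocol X' Y' Z' k' first'} {A A' : Set Answerer} {f : X → Y → Z} {f' : X' → Y' → Z'}
    {x : X} {y : Y} {x' : X'} {y' : Y'}
    (h : (∀ o ∈ A, P.output x y o = f x y) ↔ ∀ o ∈ A', P'.output x' y' o = f' x' y') :
    P.failure A f x y = P'.failure A' f' x' y' := by
  unfold failure
  by_cases h' : ∀ o ∈ A, P.output x y o = f x y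
  · rw [if_pos h', if_pos (h.1 h')]
  · rw [if_neg h', if_neg (fun h'' => h' (h.2 h''))]

/-- The failure indicator plus `lam` times the number of bits exchanged. -/
noncomputable def loss (P : Protocol X Y Z k first) (A : Set Answerer) (f : X → Y → Z)
    (lam : ℝ) (x : X) (y : Y) : ℝ :=
  P.failure A f x y + lam * (P.bits x y : ℝ)

theorem failure_eq_tail (P : Protocol X Y Z (k + 1) first) (A : Set Answerer) (f : X → Y → Z)
    (x : X) (y : Y) :
    P.failure A f x y = (P.tail (P.msg x y [] first)).failure A f x y :=
  failure_congr (by simp only [output_eq_tail])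

theorem loss_eq_tail (P : Protocol X Y Z (k + 1) first) (A : Set Answerer) (f : X → Y → Z)
    (lam : ℝ) (x : X) (y : Y) :
    P.loss A f lam x y = lam * ((P.msg x y [] first).length : ℝ)
      + (P.tail (P.msg x y [] first)).loss A f lam x y := by
  rw [loss, loss, failure_eq_tail, bits_eq_tail]
  push_cast
  ring

theorem failure_swap (P : Protocol X Y Z k first) (A : Set Answerer) (f : X → Y → Z)
    (x : X) (y : Y) :
    P.swap.failure (Answerer.swap ⁻¹' A) (fun y x => f x y) y x = P.failure A f x y := by
  have : (∀ o ∈ Answerer.swap ⁻¹' A, P.swap.output y x o = f x y) ↔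
      ∀ o ∈ A, P.output x y o = f x y := by
    simp only [output_swap, Set.mem_preimage]
    exact ⟨fun h o ho => by simpa using h o.swap (by simpa using ho), fun h o ho => h _ ho⟩
  exact failure_congr this

theorem loss_swap (P : Protocol X Y Z k first) (A : Set Answerer) (f : X → Y → Z)
    (lam : ℝ) (x : X) (y : Y) :
    P.swap.loss (Answerer.swap ⁻¹' A) (fun y x => f x y) lam y x = P.loss A f lam x y := by
  rw [loss, loss, failure_swap, bits_swap]

/-! ### Cutting off long conversations -/

/-- The number of bits in a history. -/
def used (h : History) : ℕ := (h.map List.length).sum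

/-- The protocol in which the players stop as soon as `B` bits have been exchanged. -/
def truncate (P : Protocol X Y Z k first) (B : ℕ) : Protocol X Y Z k first where
  msgAlice x h := (P.msgAlice x h).take (B - used h)
  msgBob y h := (P.msgBob y h).take (B - used h)
  outAlice := P.outAlice
  outBob := P.outBob
  outTranscript := P.outTranscript

/-- Either `l` is not shortened, and the hypothesis applies to it, or `l.take n` already has the
maximal length `n`. The cut-off point depends on the history alone, so truncation keeps a protocol
prefix-free. -/
theorem eq_of_take_prefix_take {l l' : Message} (n : ℕ) (h : l <+: l' → l = l')
    (ht : l.take n <+: l'.take n) : l.take n = l'.take n := by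
  rcases le_or_gt l.length n with hl | hl
  · rw [List.take_of_length_le hl] at ht
    rw [h (ht.trans (List.take_prefix _ _))]
  · refine ht.eq_of_length_le ?_
    simp only [List.length_take]
    omega

theorem PrefixFree.truncate {P : Protocol X Y Z k first} (h : P.PrefixFree) (B : ℕ) :
    (P.truncate B).PrefixFree :=
  ⟨fun hist x x' => eq_of_take_prefix_take _ (h.1 hist x x'),
    fun hist y y' => eq_of_take_prefix_take _ (h.2 hist y y')⟩

theorem msg_truncate (P : Protocol X Y Z k first) (B : ℕ) (x : X) (y : Y) (h : History)
    (a : Party) : (P.truncate B).msg x y h a = (P.msg x y h a).take (B - used h) := by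
  cases a <;> rfl

theorem used_append_singleton (h : History) (m : Message) :
    used (h ++ [m]) = used h + m.length := by
  simp [used]

theorem bits_truncate_le (P : Protocol X Y Z k first) (B : ℕ) (x : X) (y : Y) :
    (P.truncate B).bits x y ≤ B := by
  have : ∀ i, used ((P.truncate B).history x y i) ≤ B := by
    intro i
    induction i with
    | zero => simp [used, history]
    | succ i ih =>
      rw [history, used_append_singleton, msg_truncate, List.length_take]
      omega
  exact this k

theorem history_truncate (P : Protocol X Y Z k first) (B : ℕ) (x : X) (y : Y) (i : ℕ)
    (h : used (P.history x y i) ≤ B) : (P.truncate B).history x y i = P.history x y i := by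
  induction i with
  | zero => rfl
  | succ i ih =>
    rw [history, used_append_singleton] at h
    rw [history, history, ih (by omega), msg_truncate, List.take_of_length_le (by omega)]

/-- Markov's inequality pointwise: where the cut-off takes effect, the length term of the loss alone
is at least `1`. -/
theorem failure_truncate_le (P : Protocol X Y Z k first) (A : Set Answerer) (f : X → Y → Z)
    (B : ℕ) (lam : ℝ) (hlam : 0 ≤ lam) (x : X) (y : Y) (h : B < P.bits x y → 1 ≤ lam * P.bits x y) :
    (P.truncate B).failure A f x y ≤ P.loss A f lam x y := by
  rcases le_or_gt (P.bits x y) B with hB | hB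
  · have ht : (P.truncate B).transcript x y = P.transcript x y :=
      P.history_truncate B x y k hB
    have ho : ∀ o, (P.truncate B).output x y o = P.output x y o := by
      intro o
      cases o <;> simp only [output, ht] <;> rfl
    have : (P.truncate B).failure A f x y = P.failure A f x y :=
      failure_congr (by simp only [ho])
    rw [this, loss]
    exact le_add_of_nonneg_right (by positivity)
  · have h1 : (P.truncate B).failure A f x y ≤ 1 := by unfold failure; split_ifs <;> norm_num
    have h2 : 0 ≤ P.failure A f x y := by unfold failure; split_ifs <;> norm_num
    rw [loss]
    linarith [h hB]

end Protocol

/-! ### Compressing one round after the other -/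

open Classical in
/-- The weight of the coins that make the transcript on inputs `x`, `y` equal to `t`, if the coins
`r`, `s` have the weights `α x r` and `β y s`. -/
noncomputable def likelihood {X Y Z R S : Type*} [Fintype R] [Fintype S] {k : ℕ} {first : Party}
    (act : Protocol (X × R) (Y × S) Z k first) (α : X → R → ℝ) (β : Y → S → ℝ)
    (x : X) (y : Y) (t : History) : ℝ :=
  ∑ r, ∑ s, if act.transcript (x, r) (y, s) = t then α x r * β y s else 0

/-- The length, up to constants, of an ideal code for the transcript if the receiver predicts it
by means of the prefix weights `Q`. -/
noncomputable def codeCost {X Y Z R S : Type*} [Fintype R] [Fintype S] {k : ℕ} {first : Party}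
    (act : Protocol (X × R) (Y × S) Z k first) (α : X → R → ℝ) (β : Y → S → ℝ)
    (Q : History → ℝ) (x : X) (y : Y) (t : History) : ℝ :=
  2 * Real.logb 2 (likelihood act α β x y t * Q [] / (Q t * ((∑ r, α x r) * ∑ s, β y s))) + 10 * k

/-- Every behaviour with `k` rounds can be simulated by a deterministic prefix-free protocol, whose
loss, averaged with the weights `w`, is at most the expected failure of the given behaviour plus
`lam` times the ideal code length of its transcript. -/
def Compressible (X Y Z R S : Type*) [Fintype X] [Fintype Y] [Fintype R] [Fintype S]
    (k : ℕ) (first : Party) : Prop :=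
  ∀ (A : Set Answerer) (f : X → Y → Z) (lam : ℝ) (act : Protocol (X × R) (Y × S) Z k first)
    (α : X → R → ℝ) (β : Y → S → ℝ) (w : X → Y → ℝ) (Q : History → ℝ),
    0 ≤ lam → (∀ x r, 0 ≤ α x r) → (∀ y s, 0 ≤ β y s) → (∀ x y, 0 ≤ w x y) → (∀ h, 0 ≤ Q h) →
    (∀ (h : History) (F : Finset Message), ∑ m ∈ F, Q (h ++ [m]) ≤ Q h) →
    (∀ x y r s, 0 < w x y → 0 < α x r → 0 < β y s → 0 < Q (act.transcript (x, r) (y, s))) →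
    ∃ P : Protocol X Y Z k first, P.PrefixFree ∧
      ∑ x, ∑ y, w x y * ((∑ r, α x r) * ∑ s, β y s) * P.loss A f lam x y
        ≤ ∑ x, ∑ y, ∑ r, ∑ s, w x y * (α x r * β y s)
          * (act.failure A (fun x y => f x.1 y.1) (x, r) (y, s)
            + lam * codeCost act α β Q x y (act.transcript (x, r) (y, s)))

section

variable {X Y Z R S : Type*} [Fintype R] [Fintype S] {k : ℕ} {first : Party}

theorem likelihood_swap (act : Protocol (X × R) (Y × S) Z k first) (α : X → R → ℝ)
    (β : Y → S → ℝ) (x : X) (y : Y) (t : History) :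
    likelihood act.swap β α y x t = likelihood act α β x y t := by
  unfold likelihood
  rw [Finset.sum_comm]
  simp only [Protocol.transcript_swap, mul_comm]

theorem codeCost_swap (act : Protocol (X × R) (Y × S) Z k first) (α : X → R → ℝ)
    (β : Y → S → ℝ) (Q : History → ℝ) (x : X) (y : Y) (t : History) :
    codeCost act.swap β α Q y x t = codeCost act α β Q x y t := by
  rw [codeCost, codeCost, likelihood_swap, mul_comm (∑ s, β y s)]

variable [Fintype X] [Fintype Y]

theorem Compressible.swap (h : Compressible Y X Z S R k first.other) :
    Compressible X Y Z R S k first := by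
  intro A f lam act α β w Q hlam hα hβ hw hQ hQs hac
  obtain ⟨P, hP, hle⟩ := h (Answerer.swap ⁻¹' A) (fun y x => f x y) lam act.swap β α
    (fun y x => w x y) Q hlam hβ hα (fun y x => hw x y) hQ hQs
    (fun y x s r h1 h2 h3 => by
      rw [Protocol.transcript_swap]; exact hac x y r s h1 h3 h2)
  obtain ⟨P₀, rfl⟩ : ∃ P₀ : Protocol X Y Z k first, P₀.swap = P :=
    ⟨⟨P.msgBob, P.msgAlice, P.outBob, P.outAlice, P.outTranscript⟩, rfl⟩
  refine ⟨P₀, ⟨hP.2, hP.1⟩, ?_⟩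
  convert hle using 1
  · rw [Finset.sum_comm]
    refine Finset.sum_congr rfl fun y _ => Finset.sum_congr rfl fun x _ => ?_
    rw [Protocol.loss_swap, mul_comm (∑ s, β y s)]
  · rw [Finset.sum_comm]
    refine Finset.sum_congr rfl fun y _ => Finset.sum_congr rfl fun x _ => ?_
    rw [Finset.sum_comm]
    refine Finset.sum_congr rfl fun s _ => Finset.sum_congr rfl fun r _ => ?_
    rw [Protocol.transcript_swap, codeCost_swap, mul_comm (β y s),
      ← Protocol.failure_swap act A (fun x y => f x.1 y.1)]

/-! #### No rounds left -/

theorem exists_sum_mul_le {ι : Type*} [Fintype ι] [Nonempty ι] (v c : ι → ℝ)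
    (hv : ∀ i, 0 ≤ v i) : ∃ i, (∑ i, v i) * c i ≤ ∑ i, v i * c i := by
  obtain ⟨i, hi⟩ := Finite.exists_min c
  refine ⟨i, ?_⟩
  rw [Finset.sum_mul]
  exact Finset.sum_le_sum fun l _ => mul_le_mul_of_nonneg_left (hi l) (hv l)

/-- The players can fix their coins, depending on their inputs only. -/
theorem exists_coins_le [Nonempty R] [Nonempty S] (α : X → R → ℝ) (β : Y → S → ℝ)
    (w : X → Y → ℝ) (hα : ∀ x r, 0 ≤ α x r) (hβ : ∀ y s, 0 ≤ β y s)
    (c : X → R → Y → S → ℝ) :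
    ∃ (ρ : X → R) (σ : Y → S),
      ∑ x, ∑ y, w x y * ((∑ r, α x r) * ∑ s, β y s) * c x (ρ x) y (σ y)
        ≤ ∑ x, ∑ y, ∑ r, ∑ s, w x y * (α x r * β y s) * c x r y s := by
  -- Alice's coin is optimised against the average over Bob's input and coin, then Bob's coin
  -- against the choice already made for Alice. As the weights are products, each choice depends on
  -- the own input only.
  have h1 : ∀ x, ∃ r₀, (∑ r, α x r) * (∑ y, ∑ s, w x y * β y s * c x r₀ y s)
      ≤ ∑ r, α x r * ∑ y, ∑ s, w x y * β y s * c x r y s := fun x =>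
    exists_sum_mul_le (α x) (fun r => ∑ y, ∑ s, w x y * β y s * c x r y s) (hα x)
  choose ρ hρ using h1
  have h2 : ∀ y, ∃ s₀, (∑ s, β y s) * (∑ x, w x y * (∑ r, α x r) * c x (ρ x) y s₀)
      ≤ ∑ s, β y s * ∑ x, w x y * (∑ r, α x r) * c x (ρ x) y s := fun y =>
    exists_sum_mul_le (β y) (fun s => ∑ x, w x y * (∑ r, α x r) * c x (ρ x) y s) (hβ y)
  choose σ hσ using h2
  refine ⟨ρ, σ, ?_⟩
  calc ∑ x, ∑ y, w x y * ((∑ r, α x r) * ∑ s, β y s) * c x (ρ x) y (σ y)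
      = ∑ y, (∑ s, β y s) * (∑ x, w x y * (∑ r, α x r) * c x (ρ x) y (σ y)) := by
        rw [Finset.sum_comm]
        refine Finset.sum_congr rfl fun y _ => ?_
        rw [Finset.mul_sum]
        exact Finset.sum_congr rfl fun x _ => by ring
    _ ≤ ∑ y, ∑ s, β y s * ∑ x, w x y * (∑ r, α x r) * c x (ρ x) y s :=
        Finset.sum_le_sum fun y _ => hσ y
    _ = ∑ x, (∑ r, α x r) * (∑ y, ∑ s, w x y * β y s * c x (ρ x) y s) := by
        simp only [Finset.mul_sum]
        rw [Finset.sum_congr rfl fun y _ => Finset.sum_comm, Finset.sum_comm]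
        refine Finset.sum_congr rfl fun x _ => Finset.sum_congr rfl fun y _ =>
          Finset.sum_congr rfl fun s _ => ?_
        rw [← Finset.mul_sum]
        ring
    _ ≤ ∑ x, ∑ r, α x r * ∑ y, ∑ s, w x y * β y s * c x r y s :=
        Finset.sum_le_sum fun x _ => hρ x
    _ = ∑ x, ∑ y, ∑ r, ∑ s, w x y * (α x r * β y s) * c x r y s := by
        refine Finset.sum_congr rfl fun x _ => ?_
        rw [Finset.sum_comm]
        simp only [Finset.mul_sum]
        exact Finset.sum_congr rfl fun r _ => Finset.sum_congr rfl fun y _ =>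
          Finset.sum_congr rfl fun s _ => by ring

theorem compressible_zero [Nonempty R] [Nonempty S] : Compressible X Y Z R S 0 first := by
  intro A f lam act α β w Q hlam hα hβ hw hQ hQs hac
  obtain ⟨ρ, σ, h⟩ := exists_coins_le α β w hα hβ
    (fun x r y s => act.failure A (fun x y => f x.1 y.1) (x, r) (y, s))
  refine ⟨⟨fun _ _ => [], fun _ _ => [], fun x => act.outAlice (x, ρ x),
    fun y => act.outBob (y, σ y), act.outTranscript⟩, ⟨fun _ _ _ _ => rfl, fun _ _ _ _ => rfl⟩, ?_⟩
  convert h using 1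
  · refine Finset.sum_congr rfl fun x _ => Finset.sum_congr rfl fun y _ => ?_
    congr 1
    rw [Protocol.loss]
    have hb : ∀ P : Protocol X Y Z 0 first, P.bits x y = 0 := fun P => rfl
    rw [hb, Nat.cast_zero, mul_zero, add_zero]
    refine Protocol.failure_congr (forall₂_congr fun o _ => ?_)
    cases o <;> rfl
  · refine Finset.sum_congr rfl fun x _ => Finset.sum_congr rfl fun y _ =>
      Finset.sum_congr rfl fun r _ => Finset.sum_congr rfl fun s _ => ?_
    have ht : ∀ r s, act.transcript (x, r) (y, s) = [] := fun r s => rfl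
    have hc : codeCost act α β Q x y [] = 0 := by
      have hl : likelihood act α β x y [] = (∑ r, α x r) * ∑ s, β y s := by
        simp only [likelihood, ht, if_true, Finset.sum_mul_sum]
      rw [codeCost, hl, mul_comm (Q [])]
      set u := ((∑ r, α x r) * ∑ s, β y s) * Q []
      -- In the degenerate case `0 / 0 = 0` the logarithm is `0` as well.
      by_cases hu : u = 0
      · simp [hu]
      · simp [div_self hu]
    rw [ht, hc, mul_zero, add_zero]

end

/-! #### One more round -/

section

variable {X Y Z R S : Type*} {k : ℕ}

open Classical in
/-- The weights of Alice's coins, restricted to those that make her start with the message `m`. -/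
noncomputable def restrictCoins (act : Protocol (X × R) (Y × S) Z (k + 1) .alice)
    (α : X → R → ℝ) (m : Message) (x : X) (r : R) : ℝ :=
  if act.msgAlice (x, r) [] = m then α x r else 0

theorem restrictCoins_nonneg (act : Protocol (X × R) (Y × S) Z (k + 1) .alice)
    {α : X → R → ℝ} (hα : ∀ x r, 0 ≤ α x r) (m : Message) (x : X) (r : R) :
    0 ≤ restrictCoins act α m x r := by
  unfold restrictCoins
  split_ifs
  exacts [hα x r, le_rfl]

theorem of_restrictCoins_pos {act : Protocol (X × R) (Y × S) Z (k + 1) .alice}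
    {α : X → R → ℝ} {m : Message} {x : X} {r : R} (h : 0 < restrictCoins act α m x r) :
    act.msgAlice (x, r) [] = m ∧ 0 < α x r := by
  unfold restrictCoins at h
  split_ifs at h with h'
  · exact ⟨h', h⟩
  · exact absurd h (lt_irrefl _)

theorem likelihood_cons [Fintype R] [Fintype S]
    (act : Protocol (X × R) (Y × S) Z (k + 1) .alice) (α : X → R → ℝ) (β : Y → S → ℝ)
    (x : X) (y : Y) (m : Message) (t : History) :
    likelihood act α β x y (m :: t)
      = likelihood (act.tail m) (restrictCoins act α m) β x y t := by
  unfold likelihood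
  refine Finset.sum_congr rfl fun r _ => Finset.sum_congr rfl fun s _ => ?_
  simp only [Protocol.transcript_eq_cons, List.cons.injEq]
  by_cases h : act.msgAlice (x, r) [] = m
  · have h' : act.msg (x, r) (y, s) [] .alice = m := h
    rw [h']
    simp [restrictCoins, h]
  · have h' : ¬ act.msg (x, r) (y, s) [] .alice = m := h
    simp [restrictCoins, h, h']

theorem likelihood_transcript_pos [Fintype R] [Fintype S] {first : Party}
    (act : Protocol (X × R) (Y × S) Z k first) {α : X → R → ℝ} {β : Y → S → ℝ}
    (hα : ∀ x r, 0 ≤ α x r) (hβ : ∀ y s, 0 ≤ β y s) {x : X} {y : Y} {r : R} {s : S}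
    (hr : 0 < α x r) (hs : 0 < β y s) :
    0 < likelihood act α β x y (act.transcript (x, r) (y, s)) := by
  classical
  have h0 : ∀ r' s', 0 ≤ if act.transcript (x, r') (y, s') = act.transcript (x, r) (y, s)
      then α x r' * β y s' else 0 := fun r' s' => by
    split_ifs
    exacts [mul_nonneg (hα _ _) (hβ _ _), le_rfl]
  unfold likelihood
  refine Finset.sum_pos' (fun r' _ => Finset.sum_nonneg fun s' _ => ?_)
    ⟨r, Finset.mem_univ r, Finset.sum_pos' (fun s' _ => ?_) ⟨s, Finset.mem_univ s, ?_⟩⟩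
  · convert h0 r' s'
  · convert h0 r s'
  · rw [if_pos rfl]; exact mul_pos hr hs

theorem prefixWeight_append_le {Q : History → ℝ}
    (hQs : ∀ (h : History) (F : Finset Message), ∑ m ∈ F, Q (h ++ [m]) ≤ Q h)
    (h t : History) : Q (h ++ t) ≤ Q h := by
  induction t generalizing h with
  | nil => simp
  | cons m t ih =>
    have h1 := ih (h ++ [m])
    have h2 := hQs h {m}
    rw [Finset.sum_singleton] at h2
    simpa using h1.trans h2

/-- Chain rule: the likelihood ratio of the transcript is that of the first message times that of
the rest, with Alice's coins restricted to those producing this message. -/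
theorem codeCost_transcript_eq_tail [Fintype R] [Fintype S]
    (act : Protocol (X × R) (Y × S) Z (k + 1) .alice) {α : X → R → ℝ} {β : Y → S → ℝ}
    (hα : ∀ x r, 0 ≤ α x r) (hβ : ∀ y s, 0 ≤ β y s) {Q : History → ℝ}
    (hQs : ∀ (h : History) (F : Finset Message), ∑ m ∈ F, Q (h ++ [m]) ≤ Q h)
    {x : X} {y : Y} {r : R} {s : S} {m : Message} (hr : 0 < α x r) (hs : 0 < β y s)
    (hm : act.msgAlice (x, r) [] = m) (hQ : 0 < Q (act.transcript (x, r) (y, s))) :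
    codeCost act α β Q x y (act.transcript (x, r) (y, s))
      = 2 * Real.logb 2 ((∑ r, restrictCoins act α m x r) / (∑ r, α x r) / (Q [m] / Q [])) + 10
        + codeCost (act.tail m) (restrictCoins act α m) β (fun h => Q (m :: h)) x y
            ((act.tail m).transcript (x, r) (y, s)) := by
  have ht : act.transcript (x, r) (y, s) = m :: (act.tail m).transcript (x, r) (y, s) := by
    have h' : act.msg (x, r) (y, s) [] .alice = m := hm
    rw [Protocol.transcript_eq_cons, h']
  have hl := likelihood_transcript_pos act hα hβ hr hs
  rw [ht] at hQ hl ⊢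
  have hQm : 0 < Q [m] := hQ.trans_le
    (prefixWeight_append_le hQs [m] ((act.tail m).transcript (x, r) (y, s)))
  have hQ0 : 0 < Q [] := hQm.trans_le (prefixWeight_append_le hQs [] [m])
  have ha : 0 < ∑ r, α x r := Finset.sum_pos' (fun r _ => hα x r) ⟨r, Finset.mem_univ r, hr⟩
  have hb : 0 < ∑ s, β y s := Finset.sum_pos' (fun s _ => hβ y s) ⟨s, Finset.mem_univ s, hs⟩
  have hm' : 0 < ∑ r, restrictCoins act α m x r :=
    Finset.sum_pos' (fun r _ => restrictCoins_nonneg act hα m x r)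
      ⟨r, Finset.mem_univ r, by rw [restrictCoins, if_pos hm]; exact hr⟩
  simp only [codeCost]
  rw [likelihood_cons] at hl ⊢
  set ℓ := likelihood (act.tail m) (restrictCoins act α m) β x y
    ((act.tail m).transcript (x, r) (y, s))
  set a := ∑ r, α x r
  set b := ∑ s, β y s
  set a' := ∑ r, restrictCoins act α m x r
  set u := Q (m :: (act.tail m).transcript (x, r) (y, s))
  have : ℓ * Q [] / (u * (a * b)) = a' / a / (Q [m] / Q []) * (ℓ * Q [m] / (u * (a' * b))) := by
    field_simp
  rw [this, Real.logb_mul (by positivity) (by positivity)]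
  push_cast
  ring

variable [Fintype X] [Fintype Y] [Fintype R] [Fintype S]

/-- Alice sends the codeword of a codebook position; the cost `g` given to the codebook is the
expected cost of continuing after `m` on input `x`. The position `n` reveals not only the message `C
n` but also `sel x = n`, so the induction hypothesis is applied for each `n` with weights restricted
to such `x`. -/
theorem Compressible.alice_succ (ih : Compressible X Y Z R S k .bob) :
    Compressible X Y Z R S (k + 1) .alice := by
  classical
  intro A f lam act α β w Q hlam hα hβ hw hQ hQs hac
  set μ : X → R → Message := fun x r => act.msgAlice (x, r) [] with hμ
  set αm : Message → X → R → ℝ := restrictCoins act α with hαm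
  have hαm0 : ∀ m x r, 0 ≤ αm m x r := restrictCoins_nonneg act hα
  set a : X → ℝ := fun x => ∑ r, α x r with ha
  set am : Message → X → ℝ := fun m x => ∑ r, αm m x r with ham
  set b : Y → ℝ := fun y => ∑ s, β y s with hb
  have ha0 : ∀ x, 0 ≤ a x := fun x => Finset.sum_nonneg fun r _ => hα x r
  have ham0 : ∀ m x, 0 ≤ am m x := fun m x => Finset.sum_nonneg fun r _ => hαm0 m x r
  have hb0 : ∀ y, 0 ≤ b y := fun y => Finset.sum_nonneg fun s _ => hβ y s
  set W : X → ℝ := fun x => ∑ y, w x y * b y with hW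
  have hwb0 : ∀ x y, 0 ≤ w x y * b y := fun x y => mul_nonneg (hw x y) (hb0 y)
  have hW0 : ∀ x, 0 ≤ W x := fun x => Finset.sum_nonneg fun y _ => hwb0 x y
  set V : X → ℝ := fun x => a x * W x with hV
  have hV0 : ∀ x, 0 ≤ V x := fun x => mul_nonneg (ha0 x) (hW0 x)
  set F : Finset Message :=
    (Finset.univ.image fun z : X × R => μ z.1 z.2).filter fun m => 0 < Q [m] with hF
  have hQm : ∀ m, Q [m] ≤ Q [] := fun m => prefixWeight_append_le hQs [] [m]
  have hmemF : ∀ x y r s, 0 < w x y → 0 < α x r → 0 < β y s → μ x r ∈ F := by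
    intro x y r s h1 h2 h3
    refine Finset.mem_filter.2 ⟨Finset.mem_image.2 ⟨(x, r), Finset.mem_univ _, rfl⟩, ?_⟩
    have h4 := hac x y r s h1 h2 h3
    rw [Protocol.transcript_eq_cons] at h4
    exact h4.trans_le (prefixWeight_append_le hQs [μ x r] _)
  have hvanish : ∀ x y r s, V x = 0 → w x y * (α x r * β y s) = 0 := by
    intro x y r s h
    rcases mul_eq_zero.1 h with h | h
    · rw [(Finset.sum_eq_zero_iff_of_nonneg fun r _ => hα x r).1 h r (Finset.mem_univ r)]
      ring
    · rcases mul_eq_zero.1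
        ((Finset.sum_eq_zero_iff_of_nonneg fun y _ => hwb0 x y).1 h y (Finset.mem_univ y))
        with h | h
      · rw [h, zero_mul]
      · rw [(Finset.sum_eq_zero_iff_of_nonneg fun s _ => hβ y s).1 h s (Finset.mem_univ s)]
        ring
  set q : Message → ℝ := fun m => Q [m] / Q [] with hq
  have hqF : ∀ m ∈ F, 0 < q m := fun m hm =>
    div_pos (Finset.mem_filter.1 hm).2 ((Finset.mem_filter.1 hm).2.trans_le (hQm m))
  have hq1 : ∑ m ∈ F, q m ≤ 1 := by
    simp only [hq]
    rw [← Finset.sum_div]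
    exact div_le_one_of_le₀ (hQs [] F) (hQ [])
  have hp1 : ∀ x, 0 < V x → ∑ m ∈ F, am m x / a x = 1 := by
    intro x hx
    have hax : a x ≠ 0 := fun h => by simp [hV, h] at hx
    rw [← Finset.sum_div, div_eq_one_iff_eq hax]
    simp only [ham]
    rw [Finset.sum_comm]
    refine Finset.sum_congr rfl fun r _ => ?_
    rcases (hα x r).eq_or_lt with h0 | h0
    · simp [hαm, restrictCoins, ← h0]
    · have : μ x r ∈ F := by
        -- `V x > 0` provides some `y` and `s` of positive weight, and then `hac` makes `Q` positive
        -- on the message.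
        by_contra hcon
        refine hx.ne' (mul_eq_zero_of_right _ (Finset.sum_eq_zero fun y _ => ?_))
        by_contra hne
        have h1 := (hwb0 x y).lt_of_ne' hne
        have h2 : 0 < w x y := pos_of_mul_pos_left h1 (hb0 y)
        have h3 : 0 < b y := pos_of_mul_pos_right h1 (hw x y)
        obtain ⟨s, -, hs⟩ := Finset.exists_lt_of_sum_lt
          (show ∑ _s : S, (0 : ℝ) < ∑ s, β y s by simpa using h3)
        exact hcon (hmemF x y r s h2 h0 hs)
      simp only [hαm, restrictCoins]
      rw [Finset.sum_ite_eq, if_pos this]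
  set K : Message → X → Y → R → S → ℝ := fun m x y r s =>
    (act.tail m).failure A (fun x y => f x.1 y.1) (x, r) (y, s)
      + lam * codeCost (act.tail m) (αm m) β (fun h => Q (m :: h)) x y
          ((act.tail m).transcript (x, r) (y, s)) with hK
  set D : Message → X → ℝ := fun m x =>
    ∑ y, ∑ r, ∑ s, w x y * (αm m x r * β y s) * K m x y r s with hD
  have hDV : ∀ m x, V x = 0 → D m x = 0 := by
    intro m x h
    refine Finset.sum_eq_zero fun y _ => Finset.sum_eq_zero fun r _ =>
      Finset.sum_eq_zero fun s _ => ?_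
    have := hvanish x y r s h
    simp only [hαm, restrictCoins]
    split_ifs
    · rw [this, zero_mul]
    · simp
  have hDam : ∀ m x, am m x = 0 → D m x = 0 := by
    intro m x h
    refine Finset.sum_eq_zero fun y _ => Finset.sum_eq_zero fun r _ =>
      Finset.sum_eq_zero fun s _ => ?_
    rw [(Finset.sum_eq_zero_iff_of_nonneg fun r _ => hαm0 m x r).1 h r (Finset.mem_univ r)]
    ring
  obtain ⟨C, sel, hsel, hcode⟩ := exists_codebook F q hqF hq1 V hV0 (fun x m => am m x / a x)
    (fun x _ m => div_nonneg (ham0 m x) (ha0 x)) hp1 lam hlam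
    (fun x m => D m x / (am m x * W x))
  -- The factor `a x / am (C n) x` compensates for restricting the coins: the total weight of each
  -- selected `(x, y)` is unchanged.
  have hstep : ∀ n, ∃ P : Protocol X Y Z k .bob, P.PrefixFree ∧
      ∑ x, ∑ y, (if sel x = n then w x y * (a x / am (C n) x) else 0) * (am (C n) x * b y)
          * P.loss A f lam x y
        ≤ ∑ x, ∑ y, ∑ r, ∑ s, (if sel x = n then w x y * (a x / am (C n) x) else 0)
          * (αm (C n) x r * β y s) * K (C n) x y r s := by
    intro n
    refine ih A f lam (act.tail (C n)) (αm (C n)) β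
      (fun x y => if sel x = n then w x y * (a x / am (C n) x) else 0)
      (fun h => Q (C n :: h)) hlam (hαm0 _) hβ (fun x y => ?_) (fun h => hQ _)
      (fun h G => hQs (C n :: h) G) (fun x y r s h1 h2 h3 => ?_)
    · split_ifs
      · exact mul_nonneg (hw x y) (div_nonneg (ha0 x) (ham0 _ x))
      · exact le_rfl
    · have h4 : 0 < w x y := by
        split_ifs at h1
        · exact pos_of_mul_pos_left h1 (div_nonneg (ha0 x) (ham0 _ x))
        · exact absurd h1 (lt_irrefl _)
      obtain ⟨h5, h6⟩ := of_restrictCoins_pos h2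
      have h7 := hac x y r s h4 h6 h3
      have h8 : act.msg (x, r) (y, s) [] .alice = C n := h5
      rwa [Protocol.transcript_eq_cons, h8] at h7
  choose P hPf hPle using hstep
  refine ⟨Protocol.consAlice (fun x => codeword (sel x))
    (fun c => P (Function.invFun codeword c)),
    Protocol.prefixFree_consAlice (fun x x' h => by rw [eq_of_codeword_prefix h])
      (fun c => hPf _), ?_⟩
  have hinv : ∀ n, Function.invFun codeword (codeword n) = n :=
    Function.leftInverse_invFun codeword_injective
  have hloss : ∀ x y, (Protocol.consAlice (fun x => codeword (sel x))
      (fun c => P (Function.invFun codeword c))).loss A f lam x y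
      = lam * ((codeword (sel x)).length : ℝ) + (P (sel x)).loss A f lam x y := by
    intro x y
    have h1 : (Protocol.consAlice (fun x => codeword (sel x))
      (fun c => P (Function.invFun codeword c))).msg x y [] .alice = codeword (sel x) := rfl
    rw [Protocol.loss_eq_tail, h1, Protocol.tail_consAlice, hinv]
    rfl
  have hrest : ∑ x, ∑ y, w x y * (a x * b y) * (P (sel x)).loss A f lam x y
      ≤ ∑ x, V x * (D (C (sel x)) x / (am (C (sel x)) x * W x)) := by
    -- When the bounds for all positions are added, each `x` contributes only at `n = sel x`.
    have hsum := Finset.sum_le_sum fun n (_ : n ∈ Finset.univ.image sel) => hPle n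
    rw [Finset.sum_comm, Finset.sum_comm (s := Finset.univ.image sel)] at hsum
    have hmem : ∀ x, sel x ∈ Finset.univ.image sel := fun x =>
      Finset.mem_image_of_mem _ (Finset.mem_univ x)
    refine (le_of_eq ?_).trans (hsum.trans (le_of_eq ?_))
    · refine Finset.sum_congr rfl fun x _ => ?_
      rw [Finset.sum_eq_single_of_mem (sel x) (hmem x)
        (fun n _ hn => Finset.sum_eq_zero fun y _ => by rw [if_neg hn.symm]; ring)]
      refine Finset.sum_congr rfl fun y _ => ?_
      rw [if_pos rfl]
      rcases (hV0 x).eq_or_lt with h0 | h0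
      · have h1 : a x * (w x y * b y) = 0 := by
          rcases mul_eq_zero.1 h0.symm with h | h
          · rw [h, zero_mul]
          · rw [(Finset.sum_eq_zero_iff_of_nonneg fun y _ => hwb0 x y).1 h y
              (Finset.mem_univ y), mul_zero]
        linear_combination (P (sel x)).loss A f lam x y
          * (1 - am (C (sel x)) x / am (C (sel x)) x) * h1
      · have h1 : am (C (sel x)) x ≠ 0 := fun h => by
          have := (hsel x h0).2
          simp [h] at this
        field_simp
    · refine Finset.sum_congr rfl fun x _ => ?_
      rw [Finset.sum_eq_single_of_mem (sel x) (hmem x)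
        (fun n _ hn => Finset.sum_eq_zero fun y _ => Finset.sum_eq_zero fun r _ =>
          Finset.sum_eq_zero fun s _ => by rw [if_neg hn.symm]; ring)]
      have h2 : ∑ y, ∑ r, ∑ s, (if sel x = sel x then w x y * (a x / am (C (sel x)) x) else 0)
          * (αm (C (sel x)) x r * β y s) * K (C (sel x)) x y r s
          = a x / am (C (sel x)) x * D (C (sel x)) x := by
        simp only [hD, Finset.mul_sum, if_true]
        refine Finset.sum_congr rfl fun y _ => Finset.sum_congr rfl fun r _ =>
          Finset.sum_congr rfl fun s _ => by ring
      rw [h2]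
      rcases (hV0 x).eq_or_lt with h0 | h0
      · rw [hDV _ x h0.symm, zero_div, mul_zero, mul_zero]
      · have h1 : W x ≠ 0 := fun h => by simp [hV, h] at h0
        simp only [hV]
        rw [mul_comm (am (C (sel x)) x), ← div_div, mul_div_assoc', mul_div_assoc', mul_right_comm,
          mul_div_assoc (a x * D _ _), div_self h1]
        ring
  have hfinal : ∀ x, V x * ∑ m ∈ F, am m x / a x
        * (lam * (2 * Real.logb 2 (am m x / a x / q m) + 10) + D m x / (am m x * W x))
      = ∑ y, ∑ r, ∑ s, w x y * (α x r * β y s)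
          * (act.failure A (fun x y => f x.1 y.1) (x, r) (y, s)
            + lam * codeCost act α β Q x y (act.transcript (x, r) (y, s))) := by
    intro x
    rcases (hV0 x).eq_or_lt with h0 | h0
    · rw [← h0, zero_mul]
      refine (Finset.sum_eq_zero fun y _ => Finset.sum_eq_zero fun r _ =>
        Finset.sum_eq_zero fun s _ => ?_).symm
      rw [hvanish x y r s h0.symm, zero_mul]
    · have ha' : a x ≠ 0 := fun h => by simp [hV, h] at h0
      have hW' : W x ≠ 0 := fun h => by simp [hV, h] at h0
      have h1 : ∀ m, V x * (am m x / a x * (lam * (2 * Real.logb 2 (am m x / a x / q m) + 10)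
          + D m x / (am m x * W x)))
          = ∑ y, ∑ r, ∑ s, w x y * (αm m x r * β y s)
            * (lam * (2 * Real.logb 2 (am m x / a x / q m) + 10) + K m x y r s) := by
        intro m
        set c := lam * (2 * Real.logb 2 (am m x / a x / q m) + 10)
        have h2 : am m x * W x * c = ∑ y, ∑ r, ∑ s, w x y * (αm m x r * β y s) * c := by
          simp only [ham, hW, hb]
          rw [Finset.mul_sum, Finset.sum_mul]
          refine Finset.sum_congr rfl fun y _ => ?_
          rw [mul_left_comm (∑ r, αm m x r), Finset.sum_mul_sum, Finset.mul_sum, Finset.sum_mul]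
          refine Finset.sum_congr rfl fun r _ => ?_
          rw [Finset.mul_sum, Finset.sum_mul]
        simp only [mul_add _ c, Finset.sum_add_distrib]
        rw [← h2]
        change _ = _ + D m x
        have h3 : V x * (am m x / a x * c) = am m x * W x * c := by
          simp only [hV]; field_simp
        have h4 : V x * (am m x / a x * (D m x / (am m x * W x))) = D m x := by
          by_cases h : am m x = 0
          · rw [hDam m x h, zero_div, mul_zero, mul_zero]
          · simp only [hV]; field_simp
        rw [mul_add, h3, h4]
      rw [Finset.mul_sum, Finset.sum_congr rfl fun m _ => h1 m, Finset.sum_comm]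
      refine Finset.sum_congr rfl fun y _ => ?_
      rw [Finset.sum_comm]
      refine Finset.sum_congr rfl fun r _ => ?_
      rw [Finset.sum_comm]
      refine Finset.sum_congr rfl fun s _ => ?_
      by_cases hz : w x y * (α x r * β y s) = 0
      · rw [hz, zero_mul]
        refine Finset.sum_eq_zero fun m _ => ?_
        simp only [hαm, restrictCoins]
        split_ifs
        · rw [hz, zero_mul]
        · ring
      · have hw' : 0 < w x y := (hw x y).lt_of_ne' (by rintro h; simp [h] at hz)
        have hr : 0 < α x r := (hα x r).lt_of_ne' (by rintro h; simp [h] at hz)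
        have hs : 0 < β y s := (hβ y s).lt_of_ne' (by rintro h; simp [h] at hz)
        rw [Finset.sum_eq_single_of_mem (μ x r) (hmemF x y r s hw' hr hs)]
        · have h5 : αm (μ x r) x r = α x r := if_pos rfl
          have h6 : act.msg (x, r) (y, s) [] .alice = μ x r := rfl
          rw [h5, Protocol.failure_eq_tail, h6,
            codeCost_transcript_eq_tail act hα hβ hQs hr hs (rfl : _ = μ x r)
              (hac x y r s hw' hr hs)]
          simp only [hK, ham, ha, hq, hαm]
          ring
        · intro m _ hm
          have : αm m x r = 0 := if_neg hm.symm
          rw [this]; ring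
  calc _ = ∑ x, V x * (lam * ((codeword (sel x)).length : ℝ))
        + ∑ x, ∑ y, w x y * (a x * b y) * (P (sel x)).loss A f lam x y := by
        rw [← Finset.sum_add_distrib]
        refine Finset.sum_congr rfl fun x _ => ?_
        simp only [hV, hW]
        rw [Finset.mul_sum, Finset.sum_mul, ← Finset.sum_add_distrib]
        refine Finset.sum_congr rfl fun y _ => ?_
        rw [hloss]; ring
    _ ≤ ∑ x, V x * (lam * ((codeword (sel x)).length : ℝ))
        + ∑ x, V x * (D (C (sel x)) x / (am (C (sel x)) x * W x)) := by gcongr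
    _ = ∑ x, V x * (lam * ((codeword (sel x)).length : ℝ)
        + D (C (sel x)) x / (am (C (sel x)) x * W x)) := by
        simp only [mul_add, Finset.sum_add_distrib]
    _ ≤ _ := hcode
    _ = _ := Finset.sum_congr rfl fun x _ => hfinal x

theorem compressible [Nonempty R] [Nonempty S] (k : ℕ) (first : Party) :
    Compressible X Y Z R S k first := by
  induction k generalizing first with
  | zero => exact compressible_zero
  | succ k ih =>
    cases first with
    | alice => exact (ih .bob).alice_succ
    | bob =>
      have h1 : Compressible Y X Z S R k .bob := Compressible.swap (first := .bob) (ih .alice)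
      exact Compressible.swap (first := .bob) h1.alice_succ

end

/-! ### Entropy and mutual information as expectations -/

section Information

variable {Ω S S' : Type*} [Fintype Ω] (p : PMF Ω)

open Classical in
theorem prob_eq_sum_ite (E : Set Ω) : prob p E = ∑ ω, if ω ∈ E then (p ω).toReal else 0 := by
  rw [prob, Finset.sum_filter]

theorem prob_nonneg (E : Set Ω) : 0 ≤ prob p E := Finset.sum_nonneg fun _ _ => ENNReal.toReal_nonneg

theorem sum_toReal_eq_one : ∑ ω, (p ω).toReal = 1 := by
  rw [← ENNReal.toReal_sum fun ω _ => p.apply_ne_top ω, ← tsum_fintype (L := .unconditional Ω),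
    p.tsum_coe, ENNReal.toReal_one]

theorem prob_univ : prob p Set.univ = 1 := by
  classical
  rw [prob_eq_sum_ite]
  simpa using sum_toReal_eq_one p

theorem toReal_le_prob {E : Set Ω} {ω : Ω} (h : ω ∈ E) : (p ω).toReal ≤ prob p E := by
  classical
  exact Finset.single_le_sum (f := fun ω => (p ω).toReal) (fun _ _ => ENNReal.toReal_nonneg)
    (Finset.mem_filter.2 ⟨Finset.mem_univ ω, h⟩)

theorem prob_mono {E E' : Set Ω} (h : E ⊆ E') : prob p E ≤ prob p E' := by
  classical
  rw [prob_eq_sum_ite, prob_eq_sum_ite]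
  refine Finset.sum_le_sum fun ω _ => ?_
  by_cases hω : ω ∈ E
  · rw [if_pos hω, if_pos (h hω)]
  · rw [if_neg hω]
    split_ifs
    exacts [ENNReal.toReal_nonneg, le_rfl]

theorem prob_le_one (E : Set Ω) : prob p E ≤ 1 :=
  (prob_mono p (Set.subset_univ E)).trans_eq (prob_univ p)

theorem sum_prob_mul_eq [DecidableEq S] (V : Ω → S) (F : S → ℝ) :
    ∑ s ∈ Finset.univ.image V, prob p {ω | V ω = s} * F s = ∑ ω, (p ω).toReal * F (V ω) := by
  rw [← Finset.sum_fiberwise_of_maps_to (g := V) (t := Finset.univ.image V)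
    (fun ω _ => Finset.mem_image_of_mem V (Finset.mem_univ ω))]
  refine Finset.sum_congr rfl fun s _ => ?_
  rw [prob, Finset.sum_mul]
  simp only [Set.mem_ofPred_eq]
  refine Finset.sum_congr rfl fun ω hω => ?_
  rw [(Finset.mem_filter.1 hω).2]

theorem sum_prob_eq_one [DecidableEq S] (V : Ω → S) :
    ∑ s ∈ Finset.univ.image V, prob p {ω | V ω = s} = 1 := by
  simpa [sum_toReal_eq_one p] using sum_prob_mul_eq p V fun _ => 1

theorem entropy_eq_sum (V : Ω → S) :
    entropy p V = -∑ ω, (p ω).toReal * Real.logb 2 (prob p {ω' | V ω' = V ω}) := by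
  classical
  rw [entropy, sum_prob_mul_eq p V fun s => Real.logb 2 (prob p {ω | V ω = s})]

theorem mutualInfo_eq_sum (V : Ω → S) (W : Ω → S') :
    mutualInfo p V W = ∑ ω, (p ω).toReal * (Real.logb 2 (prob p {ω' | (V ω', W ω') = (V ω, W ω)})
      - Real.logb 2 (prob p {ω' | V ω' = V ω}) - Real.logb 2 (prob p {ω' | W ω' = W ω})) := by
  rw [mutualInfo, entropy_eq_sum, entropy_eq_sum, entropy_eq_sum]
  simp only [mul_sub, Finset.sum_sub_distrib]
  ring

/-- Gibbs' inequality via `log u ≤ u - 1`, applied to the product of the marginals over the joint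
law. It shows that the bound `a` is nonnegative. -/
theorem mutualInfo_nonneg (V : Ω → S) (W : Ω → S') : 0 ≤ mutualInfo p V W := by
  classical
  set PV : S → ℝ := fun s => prob p {ω | V ω = s} with hPV
  set PW : S' → ℝ := fun s => prob p {ω | W ω = s} with hPW
  set J : S × S' → ℝ := fun s => prob p {ω | (V ω, W ω) = s} with hJ
  have h2 : 0 < Real.log 2 := Real.log_pos one_lt_two
  have hle : ∑ ω, (p ω).toReal * (PV (V ω) * PW (W ω) / J (V ω, W ω)) ≤ 1 := by
    rw [← sum_prob_mul_eq p (fun ω => (V ω, W ω)) (fun s => PV s.1 * PW s.2 / J s)]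
    calc ∑ s ∈ Finset.univ.image fun ω => (V ω, W ω), J s * (PV s.1 * PW s.2 / J s)
        ≤ ∑ s ∈ Finset.univ.image fun ω => (V ω, W ω), PV s.1 * PW s.2 := by
          refine Finset.sum_le_sum fun s _ => ?_
          have h0 : 0 ≤ PV s.1 * PW s.2 := mul_nonneg (prob_nonneg p _) (prob_nonneg p _)
          by_cases h : J s = 0
          · rw [h, zero_mul]; exact h0
          · rw [mul_div_cancel₀ _ h]
      _ ≤ ∑ s ∈ Finset.univ.image V ×ˢ Finset.univ.image W, PV s.1 * PW s.2 := by
          refine Finset.sum_le_sum_of_subset_of_nonneg (fun s hs => ?_)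
            fun s _ _ => mul_nonneg (prob_nonneg p _) (prob_nonneg p _)
          obtain ⟨ω, -, rfl⟩ := Finset.mem_image.1 hs
          simp
      _ = 1 := by
          rw [Finset.sum_product]
          simp only
          rw [← Finset.sum_mul_sum, sum_prob_eq_one p V, sum_prob_eq_one p W, one_mul]
  have hge : ∑ ω, (p ω).toReal * ((1 - PV (V ω) * PW (W ω) / J (V ω, W ω)) / Real.log 2)
      ≤ mutualInfo p V W := by
    rw [mutualInfo_eq_sum]
    refine Finset.sum_le_sum fun ω _ => ?_
    rcases (ENNReal.toReal_nonneg : 0 ≤ (p ω).toReal).eq_or_lt with h | h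
    · rw [← h, zero_mul, zero_mul]
    · refine mul_le_mul_of_nonneg_left ?_ h.le
      change _ ≤ Real.logb 2 (J (V ω, W ω)) - Real.logb 2 (PV (V ω)) - Real.logb 2 (PW (W ω))
      have hJ0 : 0 < J (V ω, W ω) := h.trans_le (toReal_le_prob p rfl)
      have hV0 : 0 < PV (V ω) := h.trans_le (toReal_le_prob p rfl)
      have hW0 : 0 < PW (W ω) := h.trans_le (toReal_le_prob p rfl)
      have h3 := Real.log_le_sub_one_of_pos
        (show 0 < PV (V ω) * PW (W ω) / J (V ω, W ω) by positivity)
      rw [Real.log_div (by positivity) hJ0.ne', Real.log_mul hV0.ne' hW0.ne'] at h3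
      rw [Real.logb, Real.logb, Real.logb, ← sub_div, ← sub_div]
      exact div_le_div_of_nonneg_right (by linarith) h2.le
  refine le_trans ?_ hge
  simp only [← mul_div_assoc]
  rw [← Finset.sum_div]
  refine div_nonneg ?_ h2.le
  simp only [mul_sub, mul_one, Finset.sum_sub_distrib, sum_toReal_eq_one]
  linarith

end Information

/-! ### The law of inputs and coins -/

namespace PrivateCoinProtocol

variable {X Y Z R S : Type*} {k : ℕ} {first : Party}

theorem law_apply (P : PrivateCoinProtocol X Y Z R S k first) (μ : PMF (X × Y))
    (z : X × Y) (r : R) (s : S) :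
    P.law μ (z, (r, s)) = μ z * (P.coinAlice r * P.coinBob s) := by
  classical
  rw [law, PMF.bind_apply, tsum_eq_single z, PMF.bind_apply, tsum_eq_single r, PMF.map_apply,
    tsum_eq_single s]
  · simp
  · intro s' hs
    simp [hs.symm]
  · intro r' hr
    simp [PMF.map_apply, hr.symm]
  · intro z' hz
    simp [PMF.bind_apply, PMF.map_apply, hz.symm]

theorem law_toReal (P : PrivateCoinProtocol X Y Z R S k first) (μ : PMF (X × Y))
    (z : X × Y) (r : R) (s : S) :
    (P.law μ (z, (r, s))).toReal
      = (μ z).toReal * ((P.coinAlice r).toReal * (P.coinBob s).toReal) := by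
  rw [law_apply, ENNReal.toReal_mul, ENNReal.toReal_mul]

variable [Fintype X] [Fintype Y] [Fintype R] [Fintype S]

theorem sum_law_mul_eq (P : PrivateCoinProtocol X Y Z R S k first) (μ : PMF (X × Y))
    (F : (X × Y) × (R × S) → ℝ) :
    ∑ ω, (P.law μ ω).toReal * F ω = ∑ x, ∑ y, ∑ r, ∑ s,
      (μ (x, y)).toReal * ((P.coinAlice r).toReal * (P.coinBob s).toReal) * F ((x, y), (r, s)) := by
  simp only [Fintype.sum_prod_type, law_toReal]

theorem avgError_eq_sum (P : PrivateCoinProtocol X Y Z R S k first) (A : Set Answerer)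
    (f : X → Y → Z) (μ : PMF (X × Y)) :
    P.avgError A f μ = ∑ ω, (P.law μ ω).toReal
      * P.act.failure A (fun x y => f x.1 y.1) (ω.1.1, ω.2.1) (ω.1.2, ω.2.2) := by
  classical
  rw [avgError, prob_eq_sum_ite]
  refine Finset.sum_congr rfl fun ω _ => ?_
  simp only [Set.mem_ofPred_eq, Protocol.failure]
  split_ifs <;> simp_all

/-- The joint law of inputs and transcript in terms of the likelihood of the transcript. -/
theorem prob_input_transcript (P : PrivateCoinProtocol X Y Z R S k first) (μ : PMF (X × Y))
    (x : X) (y : Y) (t : History) :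
    prob (P.law μ) {ω | (ω.1, P.randomTranscript ω) = ((x, y), t)}
      = (μ (x, y)).toReal * likelihood P.act (fun _ r => (P.coinAlice r).toReal)
          (fun _ s => (P.coinBob s).toReal) x y t := by
  classical
  rw [prob_eq_sum_ite, Fintype.sum_prod_type, Finset.sum_eq_single (x, y)]
  · rw [Fintype.sum_prod_type, likelihood, Finset.mul_sum]
    refine Finset.sum_congr rfl fun r _ => ?_
    rw [Finset.mul_sum]
    refine Finset.sum_congr rfl fun s _ => ?_
    simp only [Set.mem_ofPred_eq, law_toReal, randomTranscript, Prod.mk.injEq, true_and]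
    split_ifs <;> simp
  · intro z _ hz
    refine Finset.sum_eq_zero fun c _ => if_neg ?_
    simp only [Set.mem_ofPred_eq, Prod.mk.injEq]
    exact fun h => hz h.1
  · exact fun h => absurd (Finset.mem_univ _) h

theorem prob_input (P : PrivateCoinProtocol X Y Z R S k first) (μ : PMF (X × Y)) (z : X × Y) :
    prob (P.law μ) {ω | ω.1 = z} = (μ z).toReal := by
  classical
  rw [prob_eq_sum_ite, Fintype.sum_prod_type, Finset.sum_eq_single z]
  · simp only [Set.mem_ofPred_eq, if_true, Fintype.sum_prod_type, law_toReal, ← Finset.mul_sum,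
      sum_toReal_eq_one, mul_one]
  · intro z' _ hz
    exact Finset.sum_eq_zero fun c _ => if_neg hz
  · exact fun h => absurd (Finset.mem_univ _) h

/-- The probability that the transcript starts with the history `h`. -/
noncomputable def prefixProb (P : PrivateCoinProtocol X Y Z R S k first) (μ : PMF (X × Y))
    (h : History) : ℝ :=
  prob (P.law μ) {ω | h <+: P.randomTranscript ω}

theorem sum_prefixProb_le (P : PrivateCoinProtocol X Y Z R S k first) (μ : PMF (X × Y))
    (h : History) (F : Finset Message) :
    ∑ m ∈ F, P.prefixProb μ (h ++ [m]) ≤ P.prefixProb μ h := by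
  classical
  simp only [prefixProb, prob_eq_sum_ite, Set.mem_ofPred_eq]
  rw [Finset.sum_comm]
  refine Finset.sum_le_sum fun ω _ => ?_
  by_cases hex : ∃ m ∈ F, h ++ [m] <+: P.randomTranscript ω
  · obtain ⟨m, hm, hpre⟩ := hex
    rw [Finset.sum_eq_single_of_mem m hm, if_pos hpre,
      if_pos ((List.prefix_append h [m]).trans hpre)]
    intro m' _ hne
    refine if_neg fun hpre' => hne ?_
    -- Two prefixes of equal length of one transcript coincide, so the events for different `m` are
    -- disjoint.
    have := (List.prefix_of_prefix_length_le hpre' hpre (by simp)).eq_of_length (by simp)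
    simpa using this
  · push Not at hex
    refine (Finset.sum_eq_zero fun m hm => if_neg (hex m hm)).trans_le ?_
    split_ifs
    exacts [ENNReal.toReal_nonneg, le_rfl]

theorem prefixProb_nil (P : PrivateCoinProtocol X Y Z R S k first) (μ : PMF (X × Y)) :
    P.prefixProb μ [] = 1 := by
  rw [prefixProb]
  simpa using prob_univ (P.law μ)

theorem prefixProb_transcript (P : PrivateCoinProtocol X Y Z R S k first) (μ : PMF (X × Y))
    (ω : (X × Y) × (R × S)) : P.prefixProb μ (P.randomTranscript ω)
      = prob (P.law μ) {ω' | P.randomTranscript ω' = P.randomTranscript ω} := by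
  rw [prefixProb]
  congr 1
  ext ω'
  refine ⟨fun h => (h.eq_of_length ?_).symm, fun h => ?_⟩
  · simp [randomTranscript, Protocol.transcript_length]
  · rw [Set.mem_ofPred_eq] at h ⊢
    rw [h]

/-- The simulation of a private coin protocol by a deterministic one. -/
theorem exists_protocol_loss_le (P : PrivateCoinProtocol X Y Z R S k first) (A : Set Answerer)
    (f : X → Y → Z) (μ : PMF (X × Y)) (lam : ℝ) (hlam : 0 ≤ lam) :
    ∃ P' : Protocol X Y Z k first, P'.PrefixFree ∧
      ∑ z, (μ z).toReal * P'.loss A f lam z.1 z.2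
        ≤ P.avgError A f μ + lam * (2 * P.infoCost μ + 10 * k) := by
  have : Nonempty R := P.coinAlice.support_nonempty.to_type
  have : Nonempty S := P.coinBob.support_nonempty.to_type
  have hpos : ∀ ω, 0 < (P.law μ ω).toReal → 0 < P.prefixProb μ (P.randomTranscript ω) :=
    fun ω h => h.trans_le (toReal_le_prob _ List.prefix_rfl)
  obtain ⟨P', hP', hle⟩ := compressible (X := X) (Y := Y) (Z := Z) (R := R) (S := S) k first A f lam
    P.act (fun _ r => (P.coinAlice r).toReal) (fun _ s => (P.coinBob s).toReal)
    (fun x y => (μ (x, y)).toReal) (P.prefixProb μ) hlam (fun _ _ => ENNReal.toReal_nonneg)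
    (fun _ _ => ENNReal.toReal_nonneg) (fun _ _ => ENNReal.toReal_nonneg)
    (fun _ => prob_nonneg _ _) (P.sum_prefixProb_le μ)
    (fun x y r s h1 h2 h3 => hpos ((x, y), (r, s)) (by
      rw [law_toReal]; exact mul_pos h1 (mul_pos h2 h3)))
  refine ⟨P', hP', ?_⟩
  simp only [sum_toReal_eq_one, mul_one] at hle
  rw [Fintype.sum_prod_type]
  refine hle.trans (le_of_eq ?_)
  have h10 : (10 * k : ℝ) = ∑ ω, (P.law μ ω).toReal * (10 * k) := by
    rw [← Finset.sum_mul, sum_toReal_eq_one, one_mul]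
  rw [h10, infoCost, mutualInfo_eq_sum, avgError_eq_sum, Finset.mul_sum,
    ← Finset.sum_add_distrib, Finset.mul_sum, ← Finset.sum_add_distrib]
  refine (P.sum_law_mul_eq μ fun ω => P.act.failure A (fun x y => f x.1 y.1) (ω.1.1, ω.2.1)
      (ω.1.2, ω.2.2) + lam * codeCost P.act (fun _ r => (P.coinAlice r).toReal)
        (fun _ s => (P.coinBob s).toReal) (P.prefixProb μ) ω.1.1 ω.1.2
        (P.randomTranscript ω)).symm.trans ?_
  refine Finset.sum_congr rfl fun ω _ => ?_
  rcases (ENNReal.toReal_nonneg : 0 ≤ (P.law μ ω).toReal).eq_or_lt with h | h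
  · simp [← h]
  · have hQ := hpos ω h
    have hJ : 0 < prob (P.law μ) {ω' | (ω'.1, P.randomTranscript ω')
        = ((ω.1.1, ω.1.2), P.randomTranscript ω)} := h.trans_le (toReal_le_prob _ rfl)
    have hz : 0 < (μ ω.1).toReal := by
      rw [← P.prob_input μ]
      exact h.trans_le (toReal_le_prob _ rfl)
    -- Dividing the joint probability by that of the input leaves the likelihood, so `codeCost` is
    -- twice the pointwise mutual information plus `10 * k`.
    have hJeq := P.prob_input_transcript μ ω.1.1 ω.1.2 (P.randomTranscript ω)
    rw [hJeq] at hJ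
    have hl := pos_of_mul_pos_right hJ hz.le
    simp only [Prod.mk.eta] at hJeq
    rw [hJeq, P.prob_input μ, ← prefixProb_transcript, codeCost, prefixProb_nil,
      sum_toReal_eq_one, sum_toReal_eq_one, mul_one, mul_one, mul_one,
      Real.logb_div hl.ne' hQ.ne', Real.logb_mul hz.ne' hl.ne']
    ring

end PrivateCoinProtocol

/-! ### Bounded communication and the choice of constants -/

theorem Protocol.distError_eq_sum {X Y Z : Type*} [Fintype X] [Fintype Y] {k : ℕ} {first : Party}
    (P : Protocol X Y Z k first) (A : Set Answerer) (f : X → Y → Z) (μ : PMF (X × Y)) :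
    P.distError A f μ = ∑ z, (μ z).toReal * P.failure A f z.1 z.2 := by
  classical
  rw [distError, prob_eq_sum_ite]
  refine Finset.sum_congr rfl fun z _ => ?_
  simp only [Set.mem_ofPred_eq, failure]
  split_ifs <;> simp_all

theorem Protocol.cost_le {X Y Z : Type*} [Fintype X] [Fintype Y] {k : ℕ} {first : Party}
    {P : Protocol X Y Z k first} {B : ℕ} (h : ∀ x y, P.bits x y ≤ B) : P.cost ≤ B :=
  Finset.sup_le fun z _ => h z.1 z.2

/-- A deterministic protocol of bounded cost, for every budget that exceeds the expected length of
the simulation by a factor `1 / η`. -/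
theorem PrivateCoinProtocol.exists_protocol_cost_le {X Y Z R S : Type*} [Fintype X] [Fintype Y]
    [Fintype R] [Fintype S] {k : ℕ} {first : Party} (P : PrivateCoinProtocol X Y Z R S k first)
    (A : Set Answerer) (f : X → Y → Z) (μ : PMF (X × Y)) {b η : ℝ} (hb : 0 < b)
    (h : 2 * P.infoCost μ + 10 * k ≤ η * b) :
    ∃ P' : Protocol X Y Z k first, P'.PrefixFree ∧ (P'.cost : ℝ) ≤ b ∧
      P'.distError A f μ ≤ P.avgError A f μ + η := by
  obtain ⟨P', hP', hle⟩ := P.exists_protocol_loss_le A f μ b⁻¹ (inv_nonneg.2 hb.le)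
  refine ⟨P'.truncate ⌊b⌋₊, hP'.truncate _, ?_, ?_⟩
  · exact (Nat.cast_le.2 (Protocol.cost_le (P'.bits_truncate_le _))).trans (Nat.floor_le hb.le)
  · rw [Protocol.distError_eq_sum]
    have h1 : ∑ z, (μ z).toReal * (P'.truncate ⌊b⌋₊).failure A f z.1 z.2
        ≤ ∑ z, (μ z).toReal * P'.loss A f b⁻¹ z.1 z.2 := by
      refine Finset.sum_le_sum fun z _ => mul_le_mul_of_nonneg_left
        (P'.failure_truncate_le A f _ _ (inv_nonneg.2 hb.le) _ _ fun hB => ?_)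
        ENNReal.toReal_nonneg
      rw [inv_mul_eq_div, le_div_iff₀ hb, one_mul]
      exact (Nat.lt_of_floor_lt hB).le
    have h2 : b⁻¹ * (2 * P.infoCost μ + 10 * k) ≤ η := by
      rwa [inv_mul_eq_div, div_le_iff₀ hb]
    linarith

end TwoParty

theorem mainTheorem1 {X Y Z R S : Type*} [Fintype X] [Fintype Y] [Fintype R] [Fintype S]
    (k : ℕ) (first : TwoParty.Party) (A : Set TwoParty.Answerer)
    (f : X → Y → Z) (μ : PMF (X × Y))
    (P : TwoParty.PrivateCoinProtocol X Y Z R S k first)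
    (δ a ε : ℝ) (hδ : P.avgError A f μ ≤ δ) (ha : P.infoCost μ ≤ a) (hε : 0 < ε) :
    ∃ P' : TwoParty.Protocol X Y Z k first,
      P'.PrefixFree ∧
      (P'.cost : ℝ) ≤ 2 * k * (a + 1) / ε ^ 2 + 2 * k / ε ∧
      P'.distError A f μ ≤ δ + 2 * ε := by
  have ha0 : 0 ≤ a := (TwoParty.mutualInfo_nonneg _ _ _).trans ha
  have hδ0 : 0 ≤ δ := (TwoParty.prob_nonneg _ _).trans hδ
  rcases Nat.eq_zero_or_pos k with rfl | hk
  · obtain ⟨P', hP', hle⟩ := P.exists_protocol_loss_le A f μ 0 le_rfl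
    refine ⟨P', hP', ?_, ?_⟩
    · have : P'.cost ≤ 0 := TwoParty.Protocol.cost_le fun x y => le_of_eq rfl
      simp [Nat.le_zero.1 this]
    · rw [TwoParty.Protocol.distError_eq_sum]
      simp only [TwoParty.Protocol.loss, zero_mul, add_zero] at hle
      linarith
  have hk1 : (1 : ℝ) ≤ k := by exact_mod_cast hk
  rcases le_or_gt (1 / 2) ε with hε2 | hε2
  · obtain ⟨⟨x, y⟩, -⟩ := μ.support_nonempty
    let P' : TwoParty.Protocol X Y Z k first := ⟨fun _ _ => [], fun _ _ => [],
      fun _ _ => f x y, fun _ _ => f x y, fun _ => f x y⟩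
    refine ⟨P'.truncate 0, TwoParty.Protocol.PrefixFree.truncate
      ⟨fun _ _ _ _ => rfl, fun _ _ _ _ => rfl⟩ 0, ?_, ?_⟩
    · have : (P'.truncate 0).cost ≤ 0 := TwoParty.Protocol.cost_le (P'.bits_truncate_le 0)
      rw [Nat.le_zero.1 this, Nat.cast_zero]
      positivity
    · linarith [TwoParty.prob_le_one μ
        {z | ¬ ∀ o ∈ A, (P'.truncate 0).output z.1 z.2 o = f z.1 z.2},
        show (P'.truncate 0).distError A f μ = TwoParty.prob μ
          {z | ¬ ∀ o ∈ A, (P'.truncate 0).output z.1 z.2 o = f z.1 z.2} from rfl]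
  · have hb : 0 < 2 * k * (a + 1) / ε ^ 2 + 2 * k / ε := by positivity
    obtain ⟨P', h1, h2, h3⟩ := P.exists_protocol_cost_le A f μ (η := 2 * ε) hb (by
      have h4 : 2 * ε * (2 * k * (a + 1) / ε ^ 2 + 2 * k / ε) = 4 * (k * (a + 1)) / ε + 4 * k := by
        field_simp
        ring
      -- Here `ε < 1 / 2` enters: `2 ε` times the budget is at least `8 k (a + 1) + 4 k`, which
      -- exceeds `2 a + 10 k`.
      have h5 : 8 * (k * (a + 1)) ≤ 4 * (k * (a + 1)) / ε := by
        rw [le_div_iff₀ hε]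
        have : 0 ≤ k * (a + 1) := by positivity
        nlinarith
      have h6 : a ≤ k * a := le_mul_of_one_le_left ha0 hk1
      rw [h4]
      linarith)
    exact ⟨P', h1, h2, h3.trans (by linarith)⟩
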